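/- **Conventions.** A graph is $\Gamma=(V,D,\mathrm{beg},{}^{-1})$ with a non-empty set $V$ of vertices, a set $D$ of darts, a map $\mathrm{beg}:D\to V$ and a map $x\mapsto x^{-1}$ on $D$ with $(x^{-1})^{-1}=x$; the end of $x$ is $\mathrm{beg}(x^{-1})$. An edge is a set $\{x,x^{-1}\}$; it is a semi-edge if $x=x^{-1}$ and a loop if $x\ne x^{-1}$ and $\mathrm{beg}\,x=\mathrm{beg}\,x^{-1}$. A graph is simple if it has no semi-edges, no loops and no two distinct edges with the same endvertices; it is cubic if exactly three darts begin at each vertex. Isomorphisms and automorphisms are bijections on vertices and on darts that commute with $\mathrm{beg}$ and ${}^{-1}$. A *cyclic generalised voltage graph* $(\Delta,\lambda,\iota,\zeta)$ is a finite connected graph $\Delta$ with $\lambda:D\to\mathbb Z_{>0}$, $\iota:V\to\mathbb Z_{>0}$, $\zeta:D\to\mathbb Z$ such that, for every dart $x$, $\lambda(x)\iota(\mathrm{beg}\,x)=\lambda(x^{-1})\iota(\mathrm{beg}\,x^{-1})$ and $\zeta(x^{-1})\equiv-\zeta(x)\pmod{\lambda(x)\iota(\mathrm{beg}\,x)}$.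 Its *cyclic generalised cover* has vertices $v_i$ ($v\in V$, $i\in\mathbb Z_{\iota(v)}$), darts $x_i$ ($x\in D$, $i\in\mathbb Z_{\lambda(x)\iota(\mathrm{beg}\,x)}$), $\mathrm{beg}(x_i)=(\mathrm{beg}\,x)_i$ and $(x_i)^{-1}=(x^{-1})_{i+\zeta(x)}$. **The graphs $\Gamma_i$.** For integers $m\ge1$ and $r,s\ge0$ let $\Gamma_i(m;r,s)$ (written $\Gamma_i(m;r)$ or $\Gamma_i(m)$ if $s$, or $r$ and $s$, do not occur) be the cyclic generalised cover given by row $i$ of the list below. There the vertices are $0,1,2$ (or $0,1$, or $0$), and the bracket gives their indices $\iota$. The symbol $S_a$ is a semi-edge at $a$, with label $1$ and voltage $\iota(a)/2$. The symbol $L_a(z)$ is a loop at $a$, both of its darts having label $1$ and one having voltage $z$, the other $-z$. The symbol $ab^{p,q}(z)$ is an edge whose dart from $a$ to $b$ has label $p$ and voltage $z$ and whose inverse dart has label $q$ and voltage $-z$; $(z)$ is omitted if $z=0$, and the labels are omitted if $p=q=1$. - $\Delta_1$: $[m]$; $S_0,\ L_0(r)$. - $\Delta_2$: $[m,m]$;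 $01,\ L_0(r),\ L_1(s)$. - $\Delta_3$: $[m,m]$; $01,\ 01(r),\ S_0,\ S_1$. - $\Delta_4$: $[m,m]$; $01,\ 01(r),\ 01(s)$. - $\Delta_5$: $[m,2m]$; $01^{2,1},\ S_0,\ L_1(r)$. - $\Delta_6$: $[m,3m]$; $01^{3,1},\ L_1(r)$. - $\Delta_7$: $[m,\frac{3m}2]$; $01^{3,2},\ S_1$. - $\Delta_8$: $[m,m,2m]$; $02^{2,1},\ 12^{2,1},\ 01(r),\ S_2$. - $\Delta_9$: $[\frac m2,\frac m2,m]$; $02^{2,1},\ 12^{2,1},\ S_0,\ S_1,\ S_2$. - $\Delta_{10}$: $[m,3m,\frac{3m}2]$; $01^{3,1},\ 12^{1,2},\ S_1,\ S_2$. - $\Delta_{11}$: $[m,\frac{3m}2,\frac{3m}4]$; $01^{3,2},\ 12^{1,2},\ S_2$. - $\Delta_{12}$: $[m,2m,2m]$; $01^{2,1},\ 12,\ S_0,\ S_1,\ L_2(r)$. - $\Delta_{13}$: $[m,3m,3m]$; $01^{3,1},\ 12,\ S_1,\ L_2(r)$. - $\Delta_{14}$: $[m,\frac{3m}2,\frac{3m}2]$;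 $01^{3,2},\ 12,\ L_2(r)$. - $\Delta_{15}$: $[\frac m3,\frac m3,m]$; $02^{3,1},\ 12^{3,1},\ S_2$. - $\Delta_{16}$: $[m,2m,3m]$; $02^{3,1},\ 12^{3,2}$. - $\Delta_{17}$: $[m,m,2m]$; $01,\ 12^{2,1},\ L_0(r),\ L_2(s)$. - $\Delta_{18}$: $[m,2m,4m]$; $01^{2,1},\ 12^{2,1},\ S_0,\ L_2(r)$. - $\Delta_{19}$: $[m,3m,6m]$; $01^{3,1},\ 12^{2,1},\ L_2(r)$. - $\Delta_{20}$: $[m,3m,3m]$; $01^{3,1},\ 12,\ 12(r),\ S_2$. - $\Delta_{21}$: $[m,2m,2m]$; $01^{2,1},\ 12,\ 12(r),\ S_0,\ S_2$. - $\Delta_{22}$: $[m,m,m]$; $01,\ 12,\ 01(r),\ S_0,\ L_2(s)$. - $\Delta_{23}$: $[m,m,m]$; $01,\ 12,\ 02(r),\ 02(s),\ S_1$. - $\Delta_{24}$: $[m,m,m]$; $01,\ 12,\ 02(r),\ S_0,\ S_1,\ S_2$. - $\Delta_{25}$: $[m,m,m]$; $01,\ 12,\ L_0(r),\ S_1,\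 L_2(s)$. Voltages are always taken *reduced*: $0\le z<\gcd(\iota(a),\iota(b))$ for an edge $ab^{p,q}(z)$, and $0<z<\iota(a)$, $z\neq\iota(a)/2$ for a loop $L_a(z)$. **Theorem.** A graph $\Gamma$ is a finite, connected, cubic, simple graph with a cyclic group of automorphisms $G\le\mathrm{Aut}(\Gamma)$ having at most $3$ orbits on vertices if and only if it is isomorphic to one of the following, with $m\geq 1$ and reduced voltages: 1. $\Gamma_7(4)$, $\Gamma_9(4)$, $\Gamma_{10}(4)$, $\Gamma_{11}(8)$, $\Gamma_{15}(6)$ or $\Gamma_{16}(1)$; 2. $\Gamma_1(m;r)$ with $m$ even, $m\ge4$, $r\ne0$, $\gcd(\frac m2,r)=1$; 3. $\Gamma_i(m;r)$ with $i\in\{3,12,13,14,18,20,21\}$, $m$ even, $r\neq0$, $\gcd(\frac m2,r)=1$; 4. $\Gamma_i(m;r)$ with $i\in\{6,19\}$, $r\ne0$, $\gcd(m,r)=1$; 5. $\Gamma_8(m;r)$ with $\gcd(m,r)=1$; 6. $\Gamma_i(m;r,s)$ with $i\in\{2,17\}$, $m\ge3$, $r\ne0\ne s$, $\gcd(m,r,s)=1$;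 7. $\Gamma_4(m;r,s)$ with $m\ge3$, $0<r<s$, $\gcd(m,r,s)=1$; 8. $\Gamma_5(m;r)$ with $m$ even, $r\ne0$, $\gcd(\frac m2,r)=1$; 9. $\Gamma_{23}(m;r,s)$ with $m$ even, $r\ne s$, $\gcd(\frac m2,r,s)=1$; 10. $\Gamma_{24}(m;r)$ with $m$ even, $\gcd(\frac m2,r)=1$; 11. $\Gamma_i(m;r,s)$ with $i\in\{22,25\}$, $m$ even, $m\ge4$, $r\ne0\ne s$, $\gcd(\frac m2,r,s)=1$. -/

import Mathlib

universe u v u' v'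

/-- A graph in the sense of covering theory: vertices, darts, the initial vertex of a dart and the
inverse of a dart.  Multiple edges, loops and semi-edges are allowed. -/
structure DartGraph : Type (max (u + 1) (v + 1)) where
  V : Type u
  D : Type v
  beg : D → V
  inv : D → D
  inv_inv : ∀ x, inv (inv x) = x
  nonempty : Nonempty V

namespace DartGraph

/-- The end of a dart. -/
def term (Γ : DartGraph.{u, v}) (x : Γ.D) : Γ.V := Γ.beg (Γ.inv x)

/-- There is a dart from `a` to `b`. -/
def Linked (Γ : DartGraph.{u, v}) (a b : Γ.V) : Prop := ∃ x : Γ.D, Γ.beg x = a ∧ Γ.term x = b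

/-- Any two vertices are joined by a walk. -/
def Connected (Γ : DartGraph.{u, v}) : Prop := ∀ a b : Γ.V, Relation.ReflTransGen Γ.Linked a b

/-- Every vertex has valence three. -/
def IsCubic (Γ : DartGraph.{u, v}) : Prop := ∀ a : Γ.V, Nat.card {x : Γ.D // Γ.beg x = a} = 3

/-- No semi-edges, no loops, and no two distinct parallel edges. -/
def IsSimple (Γ : DartGraph.{u, v}) : Prop :=
  (∀ x : Γ.D, Γ.inv x ≠ x) ∧
  (∀ x : Γ.D, Γ.term x ≠ Γ.beg x) ∧
  (∀ x y : Γ.D, Γ.beg x = Γ.beg y → Γ.term x = Γ.term y → y = x ∨ y = Γ.inv x)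

/-- Isomorphisms of graphs: bijections on vertices and on darts that commute with `beg`
and `inv`. -/
structure Iso (Γ : DartGraph.{u, v}) (Δ : DartGraph.{u', v'}) where
  onV : Γ.V ≃ Δ.V
  onD : Γ.D ≃ Δ.D
  map_beg : ∀ x, onV (Γ.beg x) = Δ.beg (onD x)
  map_inv : ∀ x, onD (Γ.inv x) = Δ.inv (onD x)

/-- The automorphism group, acting on vertices and darts. -/
def Aut (Γ : DartGraph.{u, v}) : Subgroup (Equiv.Perm Γ.V × Equiv.Perm Γ.D) where
  carrier := {p | ∀ x, p.1 (Γ.beg x) = Γ.beg (p.2 x) ∧ p.2 (Γ.inv x) = Γ.inv (p.2 x)}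
  one_mem' := fun x => ⟨rfl, rfl⟩
  mul_mem' := by
    intro p q hp hq x
    refine ⟨?_, ?_⟩
    · simp [(hq x).1, (hp (q.2 x)).1]
    · simp [(hq x).2, (hp (q.2 x)).2]
  inv_mem' := by
    intro p hp x
    refine ⟨?_, ?_⟩
    · have h := (hp (p.2⁻¹ x)).1
      simp only [← Equiv.Perm.mul_apply, mul_inv_cancel, Equiv.Perm.one_apply] at h
      simp only [Prod.fst_inv, Prod.snd_inv]
      rw [Equiv.Perm.inv_eq_iff_eq]
      exact h.symm
    · have h := (hp (p.2⁻¹ x)).2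
      simp only [← Equiv.Perm.mul_apply, mul_inv_cancel, Equiv.Perm.one_apply] at h
      simp only [Prod.snd_inv]
      rw [Equiv.Perm.inv_eq_iff_eq]
      exact h.symm

/-- The action of the automorphism group on the vertices. -/
instance (Γ : DartGraph.{u, v}) : MulAction Γ.Aut Γ.V where
  smul g a := g.1.1 a
  one_smul _ := rfl
  mul_smul _ _ _ := rfl

end DartGraph

/-- A cyclic generalised voltage graph `(Δ, λ, ι, ζ)`: a finite connected graph with a positive
dart-labelling `lam`, a positive index function `iota` and a voltage assignment `zeta`. -/
structure CyclicVoltageGraph where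
  Δ : DartGraph.{0, 0}
  finite_V : Finite Δ.V
  finite_D : Finite Δ.D
  connected : Δ.Connected
  lam : Δ.D → ℕ
  lam_pos : ∀ x, 0 < lam x
  iota : Δ.V → ℕ
  iota_pos : ∀ a, 0 < iota a
  ratio : ∀ x, lam x * iota (Δ.beg x) = lam (Δ.inv x) * iota (Δ.term x)
  zeta : Δ.D → ℤ
  zeta_inv : ∀ x, zeta (Δ.inv x) ≡ -zeta x [ZMOD ((lam x * iota (Δ.beg x) : ℕ) : ℤ)]

namespace CyclicVoltageGraph

/-- The inverse of the dart `x_i` of the cover is `(x⁻¹)_{i + ζ(x)}`. -/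
def coverInv (C : CyclicVoltageGraph)
    (p : Σ x : C.Δ.D, ZMod (C.lam x * C.iota (C.Δ.beg x))) :
    Σ x : C.Δ.D, ZMod (C.lam x * C.iota (C.Δ.beg x)) :=
  ⟨C.Δ.inv p.1,
    ZMod.castHom (C.ratio p.1).symm.dvd (ZMod (C.lam (C.Δ.inv p.1) * C.iota (C.Δ.term p.1))) p.2
      + (C.zeta p.1 : ZMod (C.lam (C.Δ.inv p.1) * C.iota (C.Δ.term p.1)))⟩

theorem coverInv_coverInv (C : CyclicVoltageGraph)
    (p : Σ x : C.Δ.D, ZMod (C.lam x * C.iota (C.Δ.beg x))) :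
    C.coverInv (C.coverInv p) = p := by
  obtain ⟨x, i⟩ := p
  have key : ∀ (y : C.Δ.D) (hy : y = x)
      (hd : C.lam y * C.iota (C.Δ.beg y) ∣ C.lam x * C.iota (C.Δ.beg x)),
      (⟨y, ZMod.castHom hd (ZMod (C.lam y * C.iota (C.Δ.beg y))) i⟩ :
        Σ x : C.Δ.D, ZMod (C.lam x * C.iota (C.Δ.beg x))) = ⟨x, i⟩ := by
    intro y hy hd
    subst hy
    simp
  have hinv := C.Δ.inv_inv x
  have hd : C.lam (C.Δ.inv (C.Δ.inv x)) * C.iota (C.Δ.beg (C.Δ.inv (C.Δ.inv x))) =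
      C.lam x * C.iota (C.Δ.beg x) := by rw [hinv]
  refine Eq.trans ?_ (key _ hinv hd.dvd)
  refine congrArg (Sigma.mk (C.Δ.inv (C.Δ.inv x))) ?_
  have hd2 : C.lam (C.Δ.inv (C.Δ.inv x)) * C.iota (C.Δ.beg (C.Δ.inv (C.Δ.inv x))) ∣
      C.lam (C.Δ.inv x) * C.iota (C.Δ.beg (C.Δ.inv x)) := (C.ratio (C.Δ.inv x)).symm.dvd
  have hd1 : C.lam (C.Δ.inv x) * C.iota (C.Δ.beg (C.Δ.inv x)) ∣
      C.lam x * C.iota (C.Δ.beg x) := (C.ratio x).symm.dvd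
  change ZMod.castHom hd2 (ZMod (C.lam (C.Δ.inv (C.Δ.inv x)) *
        C.iota (C.Δ.beg (C.Δ.inv (C.Δ.inv x)))))
      (ZMod.castHom hd1 (ZMod (C.lam (C.Δ.inv x) * C.iota (C.Δ.beg (C.Δ.inv x)))) i
        + ((C.zeta x : ℤ) : ZMod (C.lam (C.Δ.inv x) * C.iota (C.Δ.beg (C.Δ.inv x)))))
      + ((C.zeta (C.Δ.inv x) : ℤ) : ZMod (C.lam (C.Δ.inv (C.Δ.inv x)) *
        C.iota (C.Δ.beg (C.Δ.inv (C.Δ.inv x))))) = ZMod.castHom hd.dvd _ i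
  rw [map_add, map_intCast, add_assoc]
  have hz : ((C.zeta x : ℤ) : ZMod (C.lam (C.Δ.inv (C.Δ.inv x)) *
      C.iota (C.Δ.beg (C.Δ.inv (C.Δ.inv x))))) + ((C.zeta (C.Δ.inv x) : ℤ) : ZMod _) = 0 := by
    rw [hd, ← Int.cast_add, ZMod.intCast_zmod_eq_zero_iff_dvd]
    have h := (C.zeta_inv x).symm.dvd
    have e : C.zeta x + C.zeta (C.Δ.inv x) = C.zeta (C.Δ.inv x) - -C.zeta x := by ring
    rw [e]
    exact h
  rw [hz, add_zero]
  exact DFunLike.congr_fun (Subsingleton.elim ((ZMod.castHom hd2 _).comp (ZMod.castHom hd1 _))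
    (ZMod.castHom hd.dvd _)) i

/-- The cyclic generalised cover `CycCov(Δ, λ, ι, ζ)`. -/
def cover (C : CyclicVoltageGraph) : DartGraph.{0, 0} where
  V := Σ a : C.Δ.V, ZMod (C.iota a)
  D := Σ x : C.Δ.D, ZMod (C.lam x * C.iota (C.Δ.beg x))
  beg p := ⟨C.Δ.beg p.1, ZMod.castHom (Dvd.intro_left _ rfl) (ZMod (C.iota (C.Δ.beg p.1))) p.2⟩
  inv := C.coverInv
  inv_inv := C.coverInv_coverInv
  nonempty := C.Δ.nonempty.elim fun a => ⟨⟨a, 0⟩⟩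

end CyclicVoltageGraph

/-- An edge of a drawn diagram with vertices `Fin n`.  A semi-edge and a loop have labels `1`; the
loop at `a` has one dart of voltage `z`; `link a b p q z` is an edge whose dart from `a` to `b` has
label `p` and voltage `z` and whose dart from `b` to `a` has label `q`. -/
inductive DEdge (n : ℕ) : Type
  | semi (a : Fin n)
  | loop (a : Fin n) (z : ℕ)
  | link (a b : Fin n) (p q : ℕ) (z : ℕ)

namespace DEdge

/-- The darts underlying an edge; `true` stands for the reversed dart. -/
def Dir {n : ℕ} : DEdge n → Type
  | semi _ => Unit
  | loop _ _ => Bool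
  | link _ _ _ _ _ => Bool

def beg {n : ℕ} : (e : DEdge n) → e.Dir → Fin n
  | semi a, _ => a
  | loop a _, _ => a
  | link a _ _ _ _, false => a
  | link _ b _ _ _, true => b

def inv {n : ℕ} : (e : DEdge n) → e.Dir → e.Dir
  | semi _, d => d
  | loop _ _, d => Bool.not d
  | link _ _ _ _ _, d => Bool.not d

def lam {n : ℕ} : (e : DEdge n) → e.Dir → ℕ
  | semi _, _ => 1
  | loop _ _, _ => 1
  | link _ _ p _ _, false => p
  | link _ _ _ q _, true => q

/-- The voltage of a dart; a semi-edge at `a` has voltage `ι(a)/2`. -/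
def zeta {n : ℕ} (iota : Fin n → ℕ) : (e : DEdge n) → e.Dir → ℤ
  | semi a, _ => ((iota a / 2 : ℕ) : ℤ)
  | loop _ z, false => z
  | loop _ z, true => -z
  | link _ _ _ _ z, false => z
  | link _ _ _ _ z, true => -z

/-- The edge satisfies the requirements of a cyclic generalised voltage graph. -/
def Valid {n : ℕ} (iota : Fin n → ℕ) : DEdge n → Prop
  | semi a => Even (iota a)
  | loop _ _ => True
  | link a b p q _ => 0 < p ∧ 0 < q ∧ p * iota a = q * iota b

/-- The voltage of the edge is reduced: `0 ≤ z < gcd(ι(a), ι(b))` for an edge between `a` and `b`,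
and moreover `z ≠ 0` and `z ≠ ι(a)/2` for a loop at `a`. -/
def Reduced {n : ℕ} (iota : Fin n → ℕ) : DEdge n → Prop
  | semi _ => True
  | loop a z => 0 < z ∧ z < iota a ∧ 2 * z ≠ iota a
  | link a b _ _ z => z < Nat.gcd (iota a) (iota b)

def joins {n : ℕ} (c a : Fin n) : DEdge n → Prop
  | semi _ => False
  | loop _ _ => False
  | link a' b' _ _ _ => (a' = c ∧ b' = a) ∨ (a' = a ∧ b' = c)

theorem inv_inv {n : ℕ} (e : DEdge n) (d : e.Dir) : e.inv (e.inv d) = d := by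
  cases e
  · rfl
  · exact Bool.not_not d
  · exact Bool.not_not d

instance {n : ℕ} (e : DEdge n) : Finite e.Dir := by
  cases e
  · exact inferInstanceAs (Finite Unit)
  · exact inferInstanceAs (Finite Bool)
  · exact inferInstanceAs (Finite Bool)

end DEdge

/-- A drawn diagram: vertices `Fin n`, a list of edges, and the index function. -/
structure Diagram where
  n : ℕ
  iota : Fin n → ℕ
  edges : List (DEdge n)

namespace Diagram

structure Valid (d : Diagram) : Prop where
  iota_pos : ∀ a, 0 < d.iota a
  edges_valid : ∀ e ∈ d.edges, e.Valid d.iota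
  centre : ∃ c, ∀ a, a = c ∨ ∃ e ∈ d.edges, e.joins c a

def Reduced (d : Diagram) : Prop := ∀ e ∈ d.edges, e.Reduced d.iota

/-- The underlying graph of a diagram. -/
def graph (d : Diagram) (h : Nonempty (Fin d.n)) : DartGraph.{0, 0} where
  V := Fin d.n
  D := Σ k : Fin d.edges.length, (d.edges.get k).Dir
  beg x := (d.edges.get x.1).beg x.2
  inv x := ⟨x.1, (d.edges.get x.1).inv x.2⟩
  inv_inv x := by simp [DEdge.inv_inv]
  nonempty := h

theorem Valid.nonempty {d : Diagram} (h : d.Valid) : Nonempty (Fin d.n) :=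
  h.centre.elim fun c _ => ⟨c⟩

theorem linked_of_joins {d : Diagram} (h : Nonempty (Fin d.n)) {c a : Fin d.n} {e : DEdge d.n}
    (he : e ∈ d.edges) (hj : e.joins c a) :
    (d.graph h).Linked c a ∧ (d.graph h).Linked a c := by
  obtain ⟨k, rfl⟩ := List.get_of_mem he
  have main : ∀ e' : DEdge d.n, e'.joins c a →
      (∃ s : e'.Dir, e'.beg s = c ∧ e'.beg (e'.inv s) = a) ∧
      (∃ s : e'.Dir, e'.beg s = a ∧ e'.beg (e'.inv s) = c) := by
    intro e' h'
    cases e' with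
    | semi _ => exact h'.elim
    | loop _ _ => exact h'.elim
    | link a' b' p q z =>
      rcases h' with ⟨rfl, rfl⟩ | ⟨rfl, rfl⟩
      · exact ⟨⟨false, rfl, rfl⟩, ⟨true, rfl, rfl⟩⟩
      · exact ⟨⟨true, rfl, rfl⟩, ⟨false, rfl, rfl⟩⟩
  obtain ⟨⟨s, hs⟩, ⟨t, ht⟩⟩ := main _ hj
  exact ⟨⟨⟨k, s⟩, hs⟩, ⟨⟨k, t⟩, ht⟩⟩

theorem Valid.connected {d : Diagram} (h : d.Valid) : (d.graph h.nonempty).Connected := by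
  obtain ⟨c, hc⟩ := h.centre
  have to_c : ∀ a, Relation.ReflTransGen (d.graph h.nonempty).Linked a c := by
    intro a
    rcases hc a with rfl | ⟨e, he, hj⟩
    · exact .refl
    · exact .single (linked_of_joins h.nonempty he hj).2
  have of_c : ∀ a, Relation.ReflTransGen (d.graph h.nonempty).Linked c a := by
    intro a
    rcases hc a with rfl | ⟨e, he, hj⟩
    · exact .refl
    · exact .single (linked_of_joins h.nonempty he hj).1
  exact fun a b => (to_c a).trans (of_c b)

theorem _root_.DEdge.lam_pos {n : ℕ} {iota : Fin n → ℕ} (e : DEdge n) (h : e.Valid iota)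
    (s : e.Dir) : 0 < e.lam s := by
  cases e with
  | semi _ => exact Nat.one_pos
  | loop _ _ => exact Nat.one_pos
  | link a b p q z =>
    obtain ⟨hp, hq, _⟩ := h
    cases s
    · exact hp
    · exact hq

theorem _root_.DEdge.ratio {n : ℕ} {iota : Fin n → ℕ} (e : DEdge n) (h : e.Valid iota)
    (s : e.Dir) :
    e.lam s * iota (e.beg s) = e.lam (e.inv s) * iota (e.beg (e.inv s)) := by
  cases e with
  | semi _ => rfl
  | loop _ _ => rfl
  | link a b p q z =>
    obtain ⟨_, _, hpq⟩ := h
    cases s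
    · exact hpq
    · exact hpq.symm

theorem _root_.DEdge.zeta_inv {n : ℕ} {iota : Fin n → ℕ} (e : DEdge n) (h : e.Valid iota)
    (s : e.Dir) :
    e.zeta iota (e.inv s) ≡ -e.zeta iota s [ZMOD ((e.lam s * iota (e.beg s) : ℕ) : ℤ)] := by
  cases e with
  | semi a =>
    obtain ⟨k, hk⟩ := h
    refine (Int.modEq_iff_dvd).2 ⟨-1, ?_⟩
    simp only [DEdge.zeta, DEdge.lam, DEdge.beg]
    omega
  | loop a z => cases s <;> simp [DEdge.zeta, DEdge.inv, Int.ModEq.refl]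
  | link a b p q z => cases s <;> simp [DEdge.zeta, DEdge.inv, Int.ModEq.refl]

theorem valid_one {a : ℕ} {es : List (DEdge 1)} (ha : 0 < a)
    (h : es.Forall (DEdge.Valid ![a])) : Valid ⟨1, ![a], es⟩ where
  iota_pos := fun i => match i with
    | 0 => ha
  edges_valid := List.forall_iff_forall_mem.1 h
  centre := ⟨(0 : Fin 1), fun i => Or.inl (Subsingleton.elim (α := Fin 1) i 0)⟩

theorem valid_two {a b p q z : ℕ} {es : List (DEdge 2)} (ha : 0 < a) (hb : 0 < b)
    (h : (.link 0 1 p q z :: es : List (DEdge 2)).Forall (DEdge.Valid ![a, b])) :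
    Valid ⟨2, ![a, b], .link 0 1 p q z :: es⟩ where
  iota_pos := fun i => match i with
    | 0 => ha
    | 1 => hb
  edges_valid := List.forall_iff_forall_mem.1 h
  centre := ⟨(0 : Fin 2), fun i => match i with
    | 0 => Or.inl rfl
    | 1 => Or.inr ⟨_, List.mem_cons_self, Or.inl ⟨rfl, rfl⟩⟩⟩

theorem valid_three {a b c p q z p' q' z' : ℕ} {es : List (DEdge 3)}
    (ha : 0 < a) (hb : 0 < b) (hc : 0 < c)
    (h : (.link 0 1 p q z :: .link 1 2 p' q' z' :: es : List (DEdge 3)).Forall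
      (DEdge.Valid ![a, b, c])) :
    Valid ⟨3, ![a, b, c], .link 0 1 p q z :: .link 1 2 p' q' z' :: es⟩ where
  iota_pos := fun i => match i with
    | 0 => ha
    | 1 => hb
    | 2 => hc
  edges_valid := List.forall_iff_forall_mem.1 h
  centre := ⟨(1 : Fin 3), fun i => match i with
    | 0 => Or.inr ⟨_, List.mem_cons_self, Or.inr ⟨rfl, rfl⟩⟩
    | 1 => Or.inl rfl
    | 2 => Or.inr ⟨_, List.mem_cons_of_mem _ List.mem_cons_self, Or.inl ⟨rfl, rfl⟩⟩⟩

theorem valid_three' {a b c p q z p' q' z' : ℕ} {es : List (DEdge 3)}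
    (ha : 0 < a) (hb : 0 < b) (hc : 0 < c)
    (h : (.link 0 2 p q z :: .link 1 2 p' q' z' :: es : List (DEdge 3)).Forall
      (DEdge.Valid ![a, b, c])) :
    Valid ⟨3, ![a, b, c], .link 0 2 p q z :: .link 1 2 p' q' z' :: es⟩ where
  iota_pos := fun i => match i with
    | 0 => ha
    | 1 => hb
    | 2 => hc
  edges_valid := List.forall_iff_forall_mem.1 h
  centre := ⟨(2 : Fin 3), fun i => match i with
    | 0 => Or.inr ⟨_, List.mem_cons_self, Or.inr ⟨rfl, rfl⟩⟩
    | 1 => Or.inr ⟨_, List.mem_cons_of_mem _ List.mem_cons_self, Or.inr ⟨rfl, rfl⟩⟩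
    | 2 => Or.inl rfl⟩

/-- The cyclic generalised voltage graph depicted by a diagram. -/
def voltageGraph (d : Diagram) (h : d.Valid) : CyclicVoltageGraph where
  Δ := d.graph h.nonempty
  finite_V := inferInstanceAs (Finite (Fin d.n))
  finite_D := inferInstanceAs (Finite (Σ k : Fin d.edges.length, (d.edges.get k).Dir))
  connected := h.connected
  lam x := (d.edges.get x.1).lam x.2
  lam_pos x := (d.edges.get x.1).lam_pos (h.edges_valid _ (d.edges.get_mem x.1)) x.2
  iota := d.iota
  iota_pos := h.iota_pos
  ratio x := (d.edges.get x.1).ratio (h.edges_valid _ (d.edges.get_mem x.1)) x.2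
  zeta x := (d.edges.get x.1).zeta d.iota x.2
  zeta_inv x := (d.edges.get x.1).zeta_inv (h.edges_valid _ (d.edges.get_mem x.1)) x.2

end Diagram

open DEdge in
/-- The 25 diagrams, drawn with parameters `m`, `r`, `s`; `m` is the index of the
distinguished vertex. -/
def diagram (i m r s : ℕ) : Diagram :=
  match i with
  | 1 => ⟨1, ![m], [semi 0, loop 0 r]⟩
  | 2 => ⟨2, ![m, m], [link 0 1 1 1 0, loop 0 r, loop 1 s]⟩
  | 3 => ⟨2, ![m, m], [link 0 1 1 1 0, link 0 1 1 1 r, semi 0, semi 1]⟩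
  | 4 => ⟨2, ![m, m], [link 0 1 1 1 0, link 0 1 1 1 r, link 0 1 1 1 s]⟩
  | 5 => ⟨2, ![m, 2 * m], [link 0 1 2 1 0, semi 0, loop 1 r]⟩
  | 6 => ⟨2, ![m, 3 * m], [link 0 1 3 1 0, loop 1 r]⟩
  | 7 => ⟨2, ![m, 3 * m / 2], [link 0 1 3 2 0, semi 1]⟩
  | 8 => ⟨3, ![m, m, 2 * m], [link 0 2 2 1 0, link 1 2 2 1 0, link 0 1 1 1 r, semi 2]⟩
  | 9 => ⟨3, ![m / 2, m / 2, m], [link 0 2 2 1 0, link 1 2 2 1 0, semi 0, semi 1, semi 2]⟩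
  | 10 => ⟨3, ![m, 3 * m, 3 * m / 2], [link 0 1 3 1 0, link 1 2 1 2 0, semi 1, semi 2]⟩
  | 11 => ⟨3, ![m, 3 * m / 2, 3 * m / 4], [link 0 1 3 2 0, link 1 2 1 2 0, semi 2]⟩
  | 12 => ⟨3, ![m, 2 * m, 2 * m],
      [link 0 1 2 1 0, link 1 2 1 1 0, semi 0, semi 1, loop 2 r]⟩
  | 13 => ⟨3, ![m, 3 * m, 3 * m], [link 0 1 3 1 0, link 1 2 1 1 0, semi 1, loop 2 r]⟩
  | 14 => ⟨3, ![m, 3 * m / 2, 3 * m / 2], [link 0 1 3 2 0, link 1 2 1 1 0, loop 2 r]⟩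
  | 15 => ⟨3, ![m / 3, m / 3, m], [link 0 2 3 1 0, link 1 2 3 1 0, semi 2]⟩
  | 16 => ⟨3, ![m, 2 * m, 3 * m], [link 0 2 3 1 0, link 1 2 3 2 0]⟩
  | 17 => ⟨3, ![m, m, 2 * m], [link 0 1 1 1 0, link 1 2 2 1 0, loop 0 r, loop 2 s]⟩
  | 18 => ⟨3, ![m, 2 * m, 4 * m], [link 0 1 2 1 0, link 1 2 2 1 0, semi 0, loop 2 r]⟩
  | 19 => ⟨3, ![m, 3 * m, 6 * m], [link 0 1 3 1 0, link 1 2 2 1 0, loop 2 r]⟩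
  | 20 => ⟨3, ![m, 3 * m, 3 * m],
      [link 0 1 3 1 0, link 1 2 1 1 0, link 1 2 1 1 r, semi 2]⟩
  | 21 => ⟨3, ![m, 2 * m, 2 * m],
      [link 0 1 2 1 0, link 1 2 1 1 0, link 1 2 1 1 r, semi 0, semi 2]⟩
  | 22 => ⟨3, ![m, m, m],
      [link 0 1 1 1 0, link 1 2 1 1 0, link 0 1 1 1 r, semi 0, loop 2 s]⟩
  | 23 => ⟨3, ![m, m, m],
      [link 0 1 1 1 0, link 1 2 1 1 0, link 0 2 1 1 r, link 0 2 1 1 s, semi 1]⟩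
  | 24 => ⟨3, ![m, m, m],
      [link 0 1 1 1 0, link 1 2 1 1 0, link 0 2 1 1 r, semi 0, semi 1, semi 2]⟩
  | 25 => ⟨3, ![m, m, m],
      [link 0 1 1 1 0, link 1 2 1 1 0, loop 0 r, semi 1, loop 2 s]⟩
  | _ => ⟨0, ![], []⟩

/-- The listed conditions on the parameters of the `i`-th diagram. -/
def ParameterConditions (i m r s : ℕ) : Prop :=
  match i with
  | 7 => m = 4
  | 9 => m = 4
  | 10 => m = 4
  | 11 => m = 8
  | 15 => m = 6
  | 16 => m = 1
  | 1 => Even m ∧ 4 ≤ m ∧ r ≠ 0 ∧ Nat.gcd (m / 2) r = 1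
  | 3 | 5 | 12 | 13 | 14 | 18 | 20 | 21 => Even m ∧ r ≠ 0 ∧ Nat.gcd (m / 2) r = 1
  | 6 | 19 => r ≠ 0 ∧ Nat.gcd m r = 1
  | 8 => Nat.gcd m r = 1
  | 2 | 17 => 3 ≤ m ∧ r ≠ 0 ∧ s ≠ 0 ∧ Nat.gcd m (Nat.gcd r s) = 1
  | 4 => 3 ≤ m ∧ 0 < r ∧ r < s ∧ Nat.gcd m (Nat.gcd r s) = 1
  | 23 => Even m ∧ r ≠ s ∧ Nat.gcd (m / 2) (Nat.gcd r s) = 1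
  | 24 => Even m ∧ Nat.gcd (m / 2) r = 1
  | 22 | 25 => Even m ∧ 4 ≤ m ∧ r ≠ 0 ∧ s ≠ 0 ∧ Nat.gcd (m / 2) (Nat.gcd r s) = 1
  | _ => False

/-- The index `m` is positive, the listed conditions hold, and all voltages are reduced. -/
structure Admissible (i m r s : ℕ) : Prop where
  pos : 0 < m
  conditions : ParameterConditions i m r s
  reduced : (diagram i m r s).Reduced

theorem diagram_valid {i m r s : ℕ} (h : Admissible i m r s) : (diagram i m r s).Valid := by
  obtain ⟨hm, hc, -⟩ := h
  unfold ParameterConditions at hc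
  split at hc
  all_goals first
    | exact hc.elim
    | first
      | refine Diagram.valid_one ?_ ?_
      | refine Diagram.valid_two ?_ ?_ ?_
      | refine Diagram.valid_three ?_ ?_ ?_ ?_
      | refine Diagram.valid_three' ?_ ?_ ?_ ?_
  all_goals
    try simp only [Nat.even_iff] at hc
    first
    | omega
    | (simp [DEdge.Valid, Nat.even_iff]; done)
    | (simp [DEdge.Valid, Nat.even_iff]; omega)

/-- The graph `Γ_i(m; r, s)`. -/
def gammaGraph (i m r s : ℕ) (h : Admissible i m r s) : DartGraph.{0, 0} :=
  ((diagram i m r s).voltageGraph (diagram_valid h)).cover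

/-! Let `p` generate the cyclic group. Choose one vertex `w a` in each orbit and let `ι(a)` be the
length of that orbit. Every vertex is `p ^ t • w a` with `t` unique modulo `ι(a)`, and every edge is
a translate of some edge from `w a` to `p ^ z • w b`. So the graph is a cyclic generalised cover of
a diagram with at most three vertices, and it remains to see which diagrams occur.

The number of neighbours of `a` in the orbit of `b` (`orbitDegree`) depends only on the two orbits.
The three neighbours give row sums 3, and double counting gives the balance `d(a,b) ι(a) = d(b,a)
ι(b)` (`orbitDegree_mul_period`). These equations leave finitely many patterns. Inside one orbit of
length `m` the exponents of neighbours are closed under `n ↦ m - n`, so an odd degree forces the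
fixed point `m / 2`, a semi-edge (`even_period_of_odd`). Connectedness supplies an orbit adjacent to
all others; taking the other representatives among neighbours of its representative makes a spanning
star of voltages zero.

To identify the graph it suffices that each edge of the diagram is present (`nonempty_iso_cover`):
the map `a_t ↦ p ^ t • w a` is then a bijection on vertices that preserves adjacency, and it also
reflects adjacency because both sides have exactly three neighbours at each vertex.

For the cover itself, simplicity and valence three are local conditions on the diagram (`Good`).
Given the star of voltages zero, the cover is connected exactly when 1 is the only common divisor of
all indices and voltages (`eq_one_of_connected`, `Good.connected`). This one criterion yields all
the gcd conditions of the list and the sporadic values of `m`. Conversely, adding one to all indices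
is an automorphism of the cover whose orbits are the fibres over the vertices of the diagram. -/

namespace DartGraph

/-! ### Simple dart graphs, isomorphisms, and orbits of one automorphism. -/

variable {Γ : DartGraph.{u, v}} {Γ' : DartGraph.{u', v'}}

theorem term_inv (x : Γ.D) : Γ.term (Γ.inv x) = Γ.beg x := by
  rw [term, Γ.inv_inv]

theorem linked_dart (x : Γ.D) : Γ.Linked (Γ.beg x) (Γ.term x) := ⟨x, rfl, rfl⟩

theorem Linked.symm {a b : Γ.V} (h : Γ.Linked a b) : Γ.Linked b a := by
  obtain ⟨x, rfl, rfl⟩ := h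
  exact ⟨Γ.inv x, rfl, term_inv x⟩

/-- The alternative `y = x⁻¹` is impossible: `x⁻¹` would begin where `x` begins, making `x` a loop.
-/
theorem IsSimple.dart_ext (h : Γ.IsSimple) {x y : Γ.D} (hb : Γ.beg x = Γ.beg y)
    (ht : Γ.term x = Γ.term y) : x = y := by
  rcases h.2.2 x y hb ht with e | rfl
  · exact e.symm
  · exact absurd hb.symm (h.2.1 x)

theorem IsSimple.linked_irrefl (h : Γ.IsSimple) (a : Γ.V) : ¬ Γ.Linked a a := by
  rintro ⟨x, hb, ht⟩
  exact h.2.1 x (ht.trans hb.symm)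

/-- By simplicity a dart at `a` is determined by its end, so valence can be counted in neighbours
and darts can be ignored from here on. -/
theorem card_linked (hs : Γ.IsSimple) (hc : Γ.IsCubic) (a : Γ.V) :
    Nat.card {b : Γ.V // Γ.Linked a b} = 3 := by
  rw [← hc a]
  symm
  refine Nat.card_eq_of_bijective
    (fun x : {x : Γ.D // Γ.beg x = a} => ⟨Γ.term x.1, x.1, x.2, rfl⟩) ⟨?_, ?_⟩
  · rintro ⟨x, hx⟩ ⟨y, hy⟩ h
    exact Subtype.ext (hs.dart_ext (hx.trans hy.symm) (congrArg Subtype.val h))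
  · rintro ⟨b, x, hx, rfl⟩
    exact ⟨⟨x, hx⟩, rfl⟩

/-- A bijection between the vertices of simple graphs that preserves and reflects adjacency
extends to an isomorphism. -/
theorem nonempty_iso_of_linked (hs : Γ.IsSimple) (hs' : Γ'.IsSimple) (f : Γ.V ≃ Γ'.V)
    (hf : ∀ a b, Γ.Linked a b ↔ Γ'.Linked (f a) (f b)) : Nonempty (Γ.Iso Γ') := by
  have h1 : ∀ x : Γ.D, ∃ y : Γ'.D, Γ'.beg y = f (Γ.beg x) ∧ Γ'.term y = f (Γ.term x) :=
    fun x => (hf _ _).1 (linked_dart x)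
  choose F hb ht using h1
  have hF : Function.Bijective F := by
    refine ⟨fun x y h => ?_, fun y => ?_⟩
    · apply hs.dart_ext
      · apply f.injective
        rw [← hb, ← hb, h]
      · apply f.injective
        rw [← ht, ← ht, h]
    · obtain ⟨x, hx, hx'⟩ : Γ.Linked (f.symm (Γ'.beg y)) (f.symm (Γ'.term y)) := by
        rw [hf]
        simpa using linked_dart y
      refine ⟨x, hs'.dart_ext ?_ ?_⟩
      · rw [hb, hx, f.apply_symm_apply]
      · rw [ht, hx', f.apply_symm_apply]
  refine ⟨⟨f, Equiv.ofBijective F hF, fun x => (hb x).symm, fun x => ?_⟩⟩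
  refine hs'.dart_ext ?_ ?_
  · exact (hb _).trans (ht x).symm
  · exact ((ht _).trans (congrArg f (term_inv x))).trans ((hb x).symm.trans (term_inv _).symm)

namespace Iso

/-- The inverse of an isomorphism. -/
def symm (φ : Γ.Iso Γ') : Γ'.Iso Γ where
  onV := φ.onV.symm
  onD := φ.onD.symm
  map_beg x := by rw [Equiv.symm_apply_eq, φ.map_beg, Equiv.apply_symm_apply]
  map_inv x := by rw [Equiv.symm_apply_eq, φ.map_inv, Equiv.apply_symm_apply]

theorem map_term (φ : Γ.Iso Γ') (x : Γ.D) : φ.onV (Γ.term x) = Γ'.term (φ.onD x) := by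
  rw [term, φ.map_beg, φ.map_inv, term]

theorem linked (φ : Γ.Iso Γ') {a b : Γ.V} (h : Γ.Linked a b) :
    Γ'.Linked (φ.onV a) (φ.onV b) := by
  obtain ⟨x, rfl, rfl⟩ := h
  exact ⟨φ.onD x, (φ.map_beg x).symm, (φ.map_term x).symm⟩

theorem connected (φ : Γ.Iso Γ') (h : Γ.Connected) : Γ'.Connected := by
  intro a b
  have := Relation.ReflTransGen.lift φ.onV (fun _ _ hab => φ.linked hab) _ _
    (h (φ.onV.symm a) (φ.onV.symm b))
  simpa [Function.onFun] using this

theorem isCubic (φ : Γ.Iso Γ') (h : Γ.IsCubic) : Γ'.IsCubic := by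
  intro a
  rw [← h (φ.onV.symm a)]
  refine (Nat.card_congr (φ.onD.subtypeEquiv fun x => ?_)).symm
  rw [← φ.map_beg, Equiv.eq_symm_apply]

theorem isSimple (φ : Γ.Iso Γ') (h : Γ.IsSimple) : Γ'.IsSimple := by
  refine ⟨fun x hx => ?_, fun x hx => ?_, fun x y hb ht => ?_⟩
  · apply h.1 (φ.onD.symm x)
    rw [← Equiv.apply_eq_iff_eq φ.onD, φ.map_inv, Equiv.apply_symm_apply, hx]
  · apply h.2.1 (φ.onD.symm x)
    rw [← Equiv.apply_eq_iff_eq φ.onV, φ.map_term, φ.map_beg, Equiv.apply_symm_apply, hx]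
  · left
    rw [← Equiv.apply_eq_iff_eq φ.onD.symm]
    refine (h.dart_ext ?_ ?_).symm
    · rw [← Equiv.apply_eq_iff_eq φ.onV, φ.map_beg, φ.map_beg]
      simpa using hb
    · rw [← Equiv.apply_eq_iff_eq φ.onV, φ.map_term, φ.map_term]
      simpa using ht

/-- Conjugation of an automorphism by an isomorphism. -/
def conj (φ : Γ.Iso Γ') (p : Γ.Aut) : Γ'.Aut :=
  ⟨(φ.onV.permCongr p.1.1, φ.onD.permCongr p.1.2), fun x => by
    obtain ⟨y, rfl⟩ := φ.onD.surjective x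
    constructor
    · simp only [Equiv.permCongr_apply, Equiv.symm_apply_apply, ← φ.map_beg, (p.2 y).1]
    · simp only [Equiv.permCongr_apply, Equiv.symm_apply_apply, ← φ.map_inv, (p.2 y).2]⟩

theorem conj_smul (φ : Γ.Iso Γ') (p : Γ.Aut) (a : Γ.V) :
    φ.conj p • φ.onV a = φ.onV (p • a) := by
  change φ.onV (p.1.1 (φ.onV.symm (φ.onV a))) = φ.onV (p.1.1 a)
  rw [Equiv.symm_apply_apply]

theorem conj_zpow_smul (φ : Γ.Iso Γ') (p : Γ.Aut) (k : ℤ) (a : Γ.V) :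
    φ.conj p ^ k • φ.onV a = φ.onV (p ^ k • a) := by
  have hn : ∀ (n : ℕ) (b : Γ.V), φ.conj p ^ n • φ.onV b = φ.onV (p ^ n • b) := by
    intro n
    induction n with
    | zero => simp
    | succ n ih => intro b; rw [pow_succ, pow_succ, mul_smul, mul_smul, conj_smul, ih]
  obtain ⟨n, rfl | rfl⟩ := k.eq_nat_or_neg
  · simpa using hn n a
  · rw [zpow_neg, zpow_neg, inv_smul_eq_iff, zpow_natCast, zpow_natCast, hn, smul_inv_smul]

end Iso

/-- The family `w` only has to meet every orbit; it need not be injective. -/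
theorem card_orbits_le (p : Γ.Aut) {ι : Type*} [Finite ι] (w : ι → Γ.V)
    (hw : ∀ a, ∃ i, ∃ k : ℤ, p ^ k • w i = a) :
    Nat.card (MulAction.orbitRel.Quotient (Subgroup.zpowers p) Γ.V) ≤ Nat.card ι := by
  refine Nat.card_le_card_of_surjective
    (fun i => (Quotient.mk'' (w i) : MulAction.orbitRel.Quotient (Subgroup.zpowers p) Γ.V)) ?_
  intro q
  induction q using Quotient.inductionOn' with
  | h a =>
    obtain ⟨i, k, rfl⟩ := hw a
    refine ⟨i, Quotient.sound' ?_⟩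
    rw [MulAction.orbitRel_apply, MulAction.mem_orbit_iff]
    refine ⟨⟨p ^ (-k), Subgroup.mem_zpowers_iff.2 ⟨-k, rfl⟩⟩, ?_⟩
    change p ^ (-k) • p ^ k • w i = w i
    rw [smul_smul, ← zpow_add, neg_add_cancel, zpow_zero, one_smul]

theorem Aut.linked_iff (p : Γ.Aut) (a b : Γ.V) :
    Γ.Linked (p.1.1 a) (p.1.1 b) ↔ Γ.Linked a b := by
  have key : ∀ (q : Γ.Aut) (a b : Γ.V), Γ.Linked a b → Γ.Linked (q • a) (q • b) := by
    rintro q _ _ ⟨x, rfl, rfl⟩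
    refine ⟨q.1.2 x, (q.2 x).1.symm, ?_⟩
    rw [term, ← (q.2 x).2]
    exact (q.2 (Γ.inv x)).1.symm
  refine ⟨fun h => ?_, key p a b⟩
  have := key p⁻¹ (p • a) (p • b) h
  rwa [inv_smul_smul, inv_smul_smul] at this

end DartGraph

/-! ### Cyclic generalised covers: simplicity, valence and the shift. -/

namespace CyclicVoltageGraph

variable (C : CyclicVoltageGraph)

/-- The vertex `a_t` of the cover. -/
def vtx (a : C.Δ.V) (t : ℤ) : C.cover.V := ⟨a, (t : ZMod (C.iota a))⟩

/-- The dart `x_t` of the cover. -/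
def dart (x : C.Δ.D) (t : ℤ) : C.cover.D := ⟨x, (t : ZMod (C.lam x * C.iota (C.Δ.beg x)))⟩

variable {C}

/-- Integer indices avoid residue rings that depend on the vertex: equality of vertices becomes a
congruence (`vtx_eq_iff`), and incidence needs no casts. -/
theorem exists_eq_vtx (p : C.cover.V) : ∃ (a : C.Δ.V) (t : ℤ), p = C.vtx a t := by
  obtain ⟨a, k⟩ := p
  obtain ⟨t, ht⟩ := ZMod.intCast_surjective (n := C.iota a) k
  exact ⟨a, t, congrArg (Sigma.mk (β := fun a => ZMod (C.iota a)) a) ht.symm⟩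

theorem exists_eq_dart (p : C.cover.D) : ∃ (x : C.Δ.D) (t : ℤ), p = C.dart x t := by
  obtain ⟨x, k⟩ := p
  obtain ⟨t, ht⟩ := ZMod.intCast_surjective (n := C.lam x * C.iota (C.Δ.beg x)) k
  exact ⟨x, t, congrArg
    (Sigma.mk (β := fun x : C.Δ.D => ZMod (C.lam x * C.iota (C.Δ.beg x))) x) ht.symm⟩

theorem beg_dart (x : C.Δ.D) (t : ℤ) : C.cover.beg (C.dart x t) = C.vtx (C.Δ.beg x) t :=
  congrArg (Sigma.mk (β := fun a => ZMod (C.iota a)) (C.Δ.beg x))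
    (map_intCast (ZMod.castHom (Dvd.intro_left _ rfl) (ZMod (C.iota (C.Δ.beg x)))) t)

theorem inv_dart (x : C.Δ.D) (t : ℤ) :
    C.cover.inv (C.dart x t) = C.dart (C.Δ.inv x) (t + C.zeta x) := by
  refine congrArg (Sigma.mk (β := fun x : C.Δ.D => ZMod (C.lam x * C.iota (C.Δ.beg x)))
    (C.Δ.inv x)) ?_
  have h := map_intCast (ZMod.castHom (C.ratio x).symm.dvd
    (ZMod (C.lam (C.Δ.inv x) * C.iota (C.Δ.term x)))) t
  exact (congrArg (· + (C.zeta x : ZMod (C.lam (C.Δ.inv x) * C.iota (C.Δ.term x)))) h).trans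
    (Int.cast_add _ _).symm

theorem term_dart (x : C.Δ.D) (t : ℤ) :
    C.cover.term (C.dart x t) = C.vtx (C.Δ.term x) (t + C.zeta x) := by
  rw [DartGraph.term, inv_dart, beg_dart]
  rfl

theorem vtx_eq_iff {a b : C.Δ.V} {s t : ℤ} :
    C.vtx a s = C.vtx b t ↔ a = b ∧ s ≡ t [ZMOD C.iota a] := by
  constructor
  · intro h
    obtain ⟨rfl, h2⟩ := Sigma.mk.inj_iff.1 h
    exact ⟨rfl, (ZMod.intCast_eq_intCast_iff _ _ _).1 (eq_of_heq h2)⟩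
  · rintro ⟨rfl, h⟩
    exact congrArg (Sigma.mk a) ((ZMod.intCast_eq_intCast_iff _ _ _).2 h)

theorem dart_eq_of_modEq {x : C.Δ.D} {s t : ℤ}
    (h : s ≡ t [ZMOD (C.lam x * C.iota (C.Δ.beg x) : ℕ)]) : C.dart x s = C.dart x t :=
  congrArg (Sigma.mk x) ((ZMod.intCast_eq_intCast_iff _ _ _).2 h)

theorem linked_vtx (x : C.Δ.D) (t : ℤ) :
    C.cover.Linked (C.vtx (C.Δ.beg x) t) (C.vtx (C.Δ.term x) (t + C.zeta x)) :=
  ⟨C.dart x t, beg_dart x t, term_dart x t⟩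

theorem exists_of_linked {p q : C.cover.V} (h : C.cover.Linked p q) :
    ∃ x t, p = C.vtx (C.Δ.beg x) t ∧ q = C.vtx (C.Δ.term x) (t + C.zeta x) := by
  obtain ⟨y, rfl, rfl⟩ := h
  obtain ⟨x, t, rfl⟩ := exists_eq_dart y
  exact ⟨x, t, beg_dart x t, term_dart x t⟩

instance : Finite C.cover.V := by
  have := C.finite_V
  have : ∀ a, NeZero (C.iota a) := fun a => ⟨(C.iota_pos a).ne'⟩
  exact inferInstanceAs (Finite (Σ a : C.Δ.V, ZMod (C.iota a)))

/-- For coprime `p` and `q` the equation `p a = q b` makes the common value the least common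
multiple: `a = q c` and `b = p c`, so the value is `p q c`. -/
theorem mul_dvd_of_dvd_of_dvd {p q a b : ℕ} {k : ℤ} (ha : 0 < a) (hpq : p.Coprime q)
    (h : p * a = q * b) (hak : (a : ℤ) ∣ k) (hbk : (b : ℤ) ∣ k) : ((p * a : ℕ) : ℤ) ∣ k := by
  obtain ⟨c, rfl⟩ : q ∣ a := hpq.symm.dvd_of_dvd_mul_left ⟨b, h⟩
  have hq : 0 < q := Nat.pos_of_mul_pos_right ha
  have hb : b = p * c := by
    apply Nat.eq_of_mul_eq_mul_left hq
    rw [← h]; ring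
  subst hb
  have hc : (c : ℤ) ≠ 0 := by
    rintro hc
    have : c = 0 := by exact_mod_cast hc
    simp [this] at ha
  obtain ⟨e, rfl⟩ : (c : ℤ) ∣ k := (Dvd.intro_left (q : ℤ) (by push_cast; rfl)).trans hak
  push_cast at hak hbk ⊢
  rw [mul_comm _ (c : ℤ)] at hak hbk
  have h1 := Int.dvd_of_mul_dvd_mul_left hc hak
  have h2 := Int.dvd_of_mul_dvd_mul_left hc hbk
  have h3 : (p : ℤ) * q ∣ e := IsCoprime.mul_dvd (Nat.isCoprime_iff_coprime.2 hpq) h2 h1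
  have := mul_dvd_mul_left (c : ℤ) h3
  rwa [show (c : ℤ) * (p * q) = p * (q * c) by ring] at this

/-- A criterion for the cover to be simple. -/
theorem isSimple_cover
    (hloop : ∀ x, C.Δ.term x = C.Δ.beg x → ¬ C.zeta x ≡ 0 [ZMOD C.iota (C.Δ.beg x)])
    (hsep : ∀ x y, C.Δ.beg x = C.Δ.beg y → C.Δ.term x = C.Δ.term y →
      C.zeta x ≡ C.zeta y [ZMOD Nat.gcd (C.iota (C.Δ.beg x)) (C.iota (C.Δ.term x))] → x = y)
    (hco : ∀ x, (C.lam x).Coprime (C.lam (C.Δ.inv x))) : C.cover.IsSimple := by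
  have h2 : ∀ p : C.cover.D, C.cover.term p ≠ C.cover.beg p := by
    intro p h
    obtain ⟨x, t, rfl⟩ := exists_eq_dart p
    rw [beg_dart, term_dart, vtx_eq_iff] at h
    refine hloop x h.1 ?_
    have := h.2
    rw [h.1] at this
    exact Int.ModEq.add_left_cancel' t (by simpa using this)
  -- A semi-edge ends where it begins, so it is excluded together with the loops.
  refine ⟨fun p h => h2 p ?_, h2, fun p q hb ht => Or.inl ?_⟩
  · rw [DartGraph.term, h]
  · obtain ⟨x, s, rfl⟩ := exists_eq_dart p
    obtain ⟨y, t, rfl⟩ := exists_eq_dart q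
    rw [beg_dart, beg_dart, vtx_eq_iff] at hb
    rw [term_dart, term_dart, vtx_eq_iff] at ht
    obtain ⟨hb1, hb2⟩ := hb
    obtain ⟨ht1, ht2⟩ := ht
    -- Lifts `x_s`, `y_t` with the same ends satisfy `s ≡ t` modulo one index and `s + ζ(x) ≡ t +
    -- ζ(y)` modulo the other, hence `ζ(x) ≡ ζ(y)` modulo their gcd.
    have e : x = y := by
      refine hsep x y hb1 ht1 ?_
      refine Int.ModEq.add_left_cancel (hb2.of_dvd ?_) (ht2.of_dvd ?_)
      · exact_mod_cast Nat.gcd_dvd_left _ _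
      · exact_mod_cast Nat.gcd_dvd_right _ _
    subst e
    refine (dart_eq_of_modEq ?_).symm
    -- Now `s ≡ t` modulo both indices, hence modulo their least common multiple, which is the
    -- number of lifts of `x`.
    refine (Int.modEq_iff_dvd.2 (mul_dvd_of_dvd_of_dvd (C.iota_pos _) (hco x) (C.ratio x)
      hb2.dvd ?_))
    exact (Int.ModEq.add_right_cancel' _ ht2).dvd

/-- The fibres are cosets of the kernel, which has order `p n / n`. -/
theorem card_castHom_fibre {p n : ℕ} (hp : 0 < p) (hn : 0 < n) (i : ZMod n) :
    Nat.card {k : ZMod (p * n) // ZMod.castHom (Dvd.intro_left p rfl) (ZMod n) k = i} = p := by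
  have : NeZero n := ⟨hn.ne'⟩
  have : NeZero (p * n) := ⟨(Nat.mul_pos hp hn).ne'⟩
  let f : ZMod (p * n) →+ ZMod n := (ZMod.castHom (Dvd.intro_left p rfl) (ZMod n)).toAddMonoidHom
  have hf : Function.Surjective f := ZMod.castHom_surjective (Dvd.intro_left p rfl)
  have hker : Nat.card f.ker = p := by
    have h1 := AddSubgroup.card_mul_index f.ker
    rw [AddSubgroup.index_ker, f.range_eq_top.2 hf, AddSubgroup.card_top, Nat.card_zmod,
      Nat.card_zmod] at h1
    exact Nat.eq_of_mul_eq_mul_right hn h1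
  obtain ⟨k₀, hk₀⟩ := hf i
  refine (Nat.card_congr (β := f.ker) ((Equiv.subRight k₀).subtypeEquiv fun k => ?_)).trans hker
  change f k = i ↔ f (k - k₀) = 0
  rw [map_sub, hk₀, sub_eq_zero]

/-- The valence of a vertex of the cover is the sum of the labels at the vertex below. -/
theorem card_darts_cover [Fintype C.Δ.D] [DecidableEq C.Δ.V] (a : C.Δ.V) (i : ZMod (C.iota a)) :
    Nat.card {p : C.cover.D // C.cover.beg p = (⟨a, i⟩ : Σ a, ZMod (C.iota a))} =
      ∑ x : C.Δ.D, if C.Δ.beg x = a then C.lam x else 0 := by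
  have : ∀ x, NeZero (C.lam x * C.iota (C.Δ.beg x)) :=
    fun x => ⟨(Nat.mul_pos (C.lam_pos x) (C.iota_pos _)).ne'⟩
  have e : {p : C.cover.D // C.cover.beg p = (⟨a, i⟩ : Σ a, ZMod (C.iota a))} ≃
      Σ x : C.Δ.D, {k : ZMod (C.lam x * C.iota (C.Δ.beg x)) //
        (⟨C.Δ.beg x, ZMod.castHom (Dvd.intro_left _ rfl) (ZMod (C.iota (C.Δ.beg x))) k⟩ :
          Σ a, ZMod (C.iota a)) = ⟨a, i⟩} :=
    { toFun := fun p => ⟨p.1.1, p.1.2, p.2⟩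
      invFun := fun q => ⟨⟨q.1, q.2.1⟩, q.2.2⟩
      left_inv := fun _ => rfl
      right_inv := fun _ => rfl }
  rw [Nat.card_congr e, Nat.card_sigma]
  refine Finset.sum_congr rfl fun x _ => ?_
  split_ifs with h
  · subst h
    simp only [Sigma.mk.injEq, heq_eq_eq, true_and]
    exact card_castHom_fibre (C.lam_pos x) (C.iota_pos _) i
  · have : IsEmpty {k : ZMod (C.lam x * C.iota (C.Δ.beg x)) //
        (⟨C.Δ.beg x, ZMod.castHom (Dvd.intro_left _ rfl) (ZMod (C.iota (C.Δ.beg x))) k⟩ :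
          Σ a, ZMod (C.iota a)) = ⟨a, i⟩} := ⟨fun k => h (congrArg Sigma.fst k.2)⟩
    exact Nat.card_of_isEmpty

variable (C) in
/-- Adding one to the indices of the vertices of the cover. -/
def shiftV : Equiv.Perm C.cover.V :=
  Equiv.sigmaCongrRight fun a => Equiv.addRight (1 : ZMod (C.iota a))

variable (C) in
/-- Adding one to the indices of the darts of the cover. -/
def shiftD : Equiv.Perm C.cover.D :=
  Equiv.sigmaCongrRight fun x => Equiv.addRight (1 : ZMod (C.lam x * C.iota (C.Δ.beg x)))

theorem shiftV_vtx (a : C.Δ.V) (t : ℤ) : C.shiftV (C.vtx a t) = C.vtx a (t + 1) := by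
  change (⟨a, (t : ZMod _) + 1⟩ : Σ a, ZMod (C.iota a)) = ⟨a, _⟩
  simp

theorem shiftD_dart (x : C.Δ.D) (t : ℤ) : C.shiftD (C.dart x t) = C.dart x (t + 1) := by
  change (⟨x, (t : ZMod _) + 1⟩ : Σ x, ZMod (C.lam x * C.iota (C.Δ.beg x))) = ⟨x, _⟩
  simp

variable (C) in
/-- The automorphism of the cover that adds one to all indices. -/
def shift : C.cover.Aut :=
  ⟨(C.shiftV, C.shiftD), fun p => by
    obtain ⟨x, t, rfl⟩ := exists_eq_dart p
    constructor
    · rw [beg_dart, shiftD_dart, shiftV_vtx, beg_dart]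
    · rw [inv_dart, shiftD_dart, shiftD_dart, inv_dart, add_right_comm]⟩

theorem shift_smul (a : C.Δ.V) (t : ℤ) : C.shift • C.vtx a t = C.vtx a (t + 1) :=
  shiftV_vtx a t

theorem shift_zpow_smul (a : C.Δ.V) (k : ℤ) : C.shift ^ k • C.vtx a 0 = C.vtx a k := by
  induction k with
  | zero => simp
  | succ k ih => rw [add_comm, zpow_add, mul_smul, ih, zpow_one, shift_smul, add_comm]
  | pred k ih =>
    rw [sub_eq_add_neg, add_comm, zpow_add, mul_smul, ih, zpow_neg_one, inv_smul_eq_iff,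
      shift_smul]
    congr 1
    ring

end CyclicVoltageGraph

/-! ### Edge conditions under which lifts are neither loops, semi-edges nor parallel. -/

namespace DEdge

variable {n : ℕ}

/-- An edge between different vertices with coprime labels, a loop or a semi-edge. -/
def IsProper : DEdge n → Prop
  | semi _ => True
  | loop _ _ => True
  | link a b p q _ => a ≠ b ∧ p.Coprime q

/-- The lifts of the two edges, with reduced voltages, are not parallel. -/
def Apart : DEdge n → DEdge n → Prop
  | semi a, semi b => a ≠ b
  | loop a _, loop b _ => a ≠ b
  | link a b _ _ z, link a' b' _ _ z' => (a = a' → b = b' → z ≠ z') ∧ ¬ (a = b' ∧ b = a')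
  | _, _ => True

/-- The sum of the labels of the darts of the edge at a given vertex. -/
def deg (c : Fin n) : DEdge n → ℕ
  | semi a => if a = c then 1 else 0
  | loop a _ => if a = c then 2 else 0
  | link a b p q _ => (if a = c then p else 0) + if b = c then q else 0

/-- The voltage of the edge, as a natural number. -/
def volt (iota : Fin n → ℕ) : DEdge n → ℕ
  | semi a => iota a / 2
  | loop _ z => z
  | link _ _ _ _ z => z

theorem Apart.symm {e e' : DEdge n} (h : e.Apart e') : e'.Apart e := by
  cases e <;> cases e' <;> simp_all [Apart] <;> grind

theorem not_modEq_zero_of_lt {z m : ℕ} (h0 : 0 < z) (h : z < m) : ¬ (z : ℤ) ≡ 0 [ZMOD m] := by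
  intro hz
  have := Int.natCast_dvd_natCast.1 (Int.modEq_zero_iff_dvd.1 hz)
  exact absurd (Nat.le_of_dvd h0 this) (by omega)

/-- Separates a semi-edge from a loop at the same vertex: `m / 2 ≡ ±z` with `0 < z < m` would force
`2 z = m`. -/
theorem not_half_modEq {z m : ℕ} (hm : Even m) (h0 : 0 < z) (h : z < m) (h2 : 2 * z ≠ m)
    {w : ℤ} (hw : w = z ∨ w = -z) : ¬ ((m / 2 : ℕ) : ℤ) ≡ w [ZMOD m] := by
  obtain ⟨k, rfl⟩ := hm
  rw [show (k + k) / 2 = k by omega, Int.modEq_iff_dvd]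
  rintro ⟨c, hc⟩
  push_cast at hc
  have h1 : -2 < c := by by_contra; rcases hw with rfl | rfl <;> nlinarith
  have h2 : c < 2 := by by_contra; rcases hw with rfl | rfl <;> nlinarith
  interval_cases c <;> omega

/-- Separates the two darts of one loop: `m ∣ 2 z` with `0 < 2 z < 2 m` would force `2 z = m`. -/
theorem not_loop_modEq {z m : ℕ} (h0 : 0 < z) (h : z < m) (h2 : 2 * z ≠ m) :
    ¬ (z : ℤ) ≡ -z [ZMOD m] := by
  rw [Int.modEq_iff_dvd]
  rintro ⟨c, hc⟩
  have h1 : -2 < c := by by_contra; nlinarith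
  have h2 : c < 0 := by by_contra; nlinarith
  interval_cases c; omega

theorem zeta_not_modEq_zero {iota : Fin n → ℕ} {e : DEdge n} (hpos : ∀ a, 0 < iota a)
    (hv : e.Valid iota) (hr : e.Reduced iota) (hp : e.IsProper) (d : e.Dir)
    (h : e.beg (e.inv d) = e.beg d) : ¬ e.zeta iota d ≡ 0 [ZMOD iota (e.beg d)] := by
  cases e with
  | semi a =>
    have := hpos a
    obtain ⟨k, hk⟩ := hv
    change ¬ ((iota a / 2 : ℕ) : ℤ) ≡ 0 [ZMOD iota a]
    exact not_modEq_zero_of_lt (by omega) (by omega)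
  | loop a z =>
    obtain ⟨h0, h1, -⟩ := hr
    cases d with
    | false => exact not_modEq_zero_of_lt h0 h1
    | true =>
      intro hz
      apply not_modEq_zero_of_lt h0 h1
      simpa [zeta, beg] using hz.neg
  | link a b p q z =>
    cases d with
    | false => exact absurd h.symm hp.1
    | true => exact absurd h hp.1

/-- Supplies the separation hypothesis of `isSimple_cover` for darts of different edges. Two links
with the same ends have voltages below the gcd of the indices, so congruent voltages are equal;
`Apart` also forbids drawing them in opposite directions. -/
theorem apart_zeta {iota : Fin n → ℕ} {e e' : DEdge n} (ha : e.Apart e')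
    (hv : e.Valid iota) (hr : e.Reduced iota) (hp : e.IsProper)
    (hv' : e'.Valid iota) (hr' : e'.Reduced iota) (hp' : e'.IsProper) (d : e.Dir) (d' : e'.Dir)
    (hb : e.beg d = e'.beg d') (ht : e.beg (e.inv d) = e'.beg (e'.inv d')) :
    ¬ e.zeta iota d ≡ e'.zeta iota d'
      [ZMOD Nat.gcd (iota (e.beg d)) (iota (e.beg (e.inv d)))] := by
  cases e with
  | semi a =>
    cases e' with
    | semi a' => exact absurd hb ha
    | loop a' z =>
      obtain rfl : a = a' := by cases d' <;> exact hb
      obtain ⟨h0, h1, h2⟩ := hr'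
      have := fun w hw => not_half_modEq (w := w) hv h0 h1 h2 hw
      cases d' <;> simp only [zeta, beg, Nat.gcd_self] <;> apply this <;> simp
    | link a' b' p q z =>
      cases d' <;> simp only [beg, inv, Bool.not_true, Bool.not_false] at hb ht <;>
        exact absurd (hb.symm.trans ht) (by first | exact hp'.1 | exact hp'.1.symm)
  | loop a z =>
    cases e' with
    | semi a' =>
      obtain rfl : a = a' := by cases d <;> exact hb
      obtain ⟨h0, h1, h2⟩ := hr
      have := fun w hw h => not_half_modEq (w := w) hv' h0 h1 h2 hw (Int.ModEq.symm h)
      cases d <;> simp only [zeta, beg, Nat.gcd_self] <;> apply this <;> simp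
    | loop a' z' => exact absurd (by cases d <;> cases d' <;> exact hb) ha
    | link a' b' p q z' =>
      cases d <;> cases d' <;> simp only [beg, inv, Bool.not_true, Bool.not_false] at hb ht <;>
        exact absurd (hb.symm.trans ht) (by first | exact hp'.1 | exact hp'.1.symm)
  | link a b p q z =>
    cases e' with
    | semi a' =>
      cases d <;> simp only [beg, inv, Bool.not_true, Bool.not_false] at hb ht <;>
        exact absurd (hb.trans ht.symm) (by first | exact hp.1 | exact hp.1.symm)
    | loop a' z' =>
      cases d <;> cases d' <;> simp only [beg, inv, Bool.not_true, Bool.not_false] at hb ht <;>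
        exact absurd (hb.trans ht.symm) (by first | exact hp.1 | exact hp.1.symm)
    | link a' b' p' q' z' =>
      have key : ∀ g : ℕ, z < g → z' < g → (z : ℤ) ≡ z' [ZMOD g] → z = z' := fun g h1 h2 h =>
        Nat.ModEq.eq_of_lt_of_lt (Int.natCast_modEq_iff.1 h) h1 h2
      cases d <;> cases d' <;>
        simp only [beg, inv, zeta, Bool.not_true, Bool.not_false] at hb ht ⊢
      · subst hb; subst ht
        exact fun h => ha.1 rfl rfl (key _ hr hr' h)
      · exact absurd ⟨hb, ht⟩ ha.2
      · exact absurd ⟨ht, hb⟩ ha.2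
      -- Both darts are reversed, so both voltages change sign.
      · subst hb; subst ht
        rw [Nat.gcd_comm]
        intro h
        exact ha.1 rfl rfl (key _ hr hr' (by simpa using h.neg))

theorem dir_eq {iota : Fin n → ℕ} {e : DEdge n} (hr : e.Reduced iota) (hp : e.IsProper)
    {d d' : e.Dir} (hb : e.beg d = e.beg d')
    (hz : e.zeta iota d ≡ e.zeta iota d'
      [ZMOD Nat.gcd (iota (e.beg d)) (iota (e.beg (e.inv d)))]) : d = d' := by
  cases e with
  | semi a => rfl
  | loop a z =>
    obtain ⟨h0, h1, h2⟩ := hr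
    have := not_loop_modEq h0 h1 h2
    cases d <;> cases d' <;> first | rfl | skip
    · exact absurd (by simpa [zeta, beg, inv] using hz) this
    · exact absurd (by simpa [zeta, beg, inv] using hz.symm) this
  | link a b p q z =>
    cases d <;> cases d' <;> first | rfl | skip
    · exact absurd hb hp.1
    · exact absurd hb.symm hp.1

end DEdge

/-! ### Diagrams with cubic simple covers, and connectedness of the cover. -/

namespace Diagram

/-- A diagram whose cyclic generalised cover is cubic and simple. -/
structure Good (d : Diagram) : Prop where
  valid : d.Valid
  reduced : d.Reduced
  proper : ∀ e ∈ d.edges, e.IsProper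
  apart : d.edges.Pairwise DEdge.Apart
  degree : ∀ a, (d.edges.map (DEdge.deg a)).sum = 3
  -- Unlike `Valid.centre`, this asks for voltage zero on the star. Only the proof of connectedness
  -- uses it.
  star : ∃ c, ∀ a, a = c ∨ ∃ p q, .link c a p q 0 ∈ d.edges ∨ .link a c p q 0 ∈ d.edges

/-- `N` divides all indices and all voltages. -/
def CommonDivisor (d : Diagram) (N : ℕ) : Prop :=
  (∀ a, N ∣ d.iota a) ∧ ∀ e ∈ d.edges, N ∣ e.volt d.iota

variable {d : Diagram}

theorem Good.isSimple (h : d.Good) : (d.voltageGraph h.valid).cover.IsSimple := by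
  refine CyclicVoltageGraph.isSimple_cover ?_ ?_ ?_
  · rintro ⟨k, s⟩ ht
    have hk := d.edges.get_mem k
    exact DEdge.zeta_not_modEq_zero h.valid.iota_pos (h.valid.edges_valid _ hk) (h.reduced _ hk)
      (h.proper _ hk) s ht
  · rintro ⟨k, s⟩ ⟨k', s'⟩ hb ht hz
    have hk := d.edges.get_mem k
    have hk' := d.edges.get_mem k'
    by_cases e : k = k'
    · subst e
      have := DEdge.dir_eq (h.reduced _ hk) (h.proper _ hk) hb hz
      exact congrArg (Sigma.mk (β := fun k => (d.edges.get k).Dir) k) this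
    · refine absurd hz (DEdge.apart_zeta ?_ (h.valid.edges_valid _ hk) (h.reduced _ hk)
        (h.proper _ hk) (h.valid.edges_valid _ hk') (h.reduced _ hk') (h.proper _ hk') s s' hb ht)
      have hp := List.pairwise_iff_get.1 h.apart
      rcases lt_or_gt_of_ne e with hlt | hlt
      · exact hp _ _ hlt
      · exact (hp _ _ hlt).symm
  · rintro ⟨k, s⟩
    have hk := h.proper _ (d.edges.get_mem k)
    change (DEdge.lam _ s).Coprime (DEdge.lam _ ((d.edges.get k).inv s))
    generalize d.edges.get k = e at s hk
    cases e with
    | semi a => exact Nat.coprime_one_left 1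
    | loop a z => exact Nat.coprime_one_left 1
    | link a b p q z =>
      cases s
      · exact hk.2
      · exact hk.2.symm

/-- The `Fintype` instance is arbitrary because `Dir` only carries `Finite`; it is identified with
the standard one before the sum is expanded. -/
theorem sum_lam_eq_deg {n : ℕ} (e : DEdge n) (a : Fin n) [inst : Fintype e.Dir] :
    (∑ s : e.Dir, if e.beg s = a then e.lam s else 0) = e.deg a := by
  cases e with
  | semi b =>
    obtain rfl : inst = inferInstanceAs (Fintype Unit) := Subsingleton.elim _ _
    exact Fintype.sum_unique (ι := Unit) _
  | loop b z =>
    obtain rfl : inst = inferInstanceAs (Fintype Bool) := Subsingleton.elim _ _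
    refine (Fintype.sum_bool (fun s : Bool => if DEdge.beg (.loop b z) s = a then
      DEdge.lam (.loop b z) s else 0)).trans ?_
    change (if b = a then 1 else 0) + (if b = a then 1 else 0) = if b = a then 2 else 0
    split_ifs <;> rfl
  | link b c p q z =>
    obtain rfl : inst = inferInstanceAs (Fintype Bool) := Subsingleton.elim _ _
    refine (Fintype.sum_bool (fun s : Bool => if DEdge.beg (.link b c p q z) s = a then
      DEdge.lam (.link b c p q z) s else 0)).trans ?_
    exact add_comm (if c = a then q else 0) (if b = a then p else 0)

theorem sum_lam_graph_eq (h : Nonempty (Fin d.n)) (a : Fin d.n) [inst : Fintype (d.graph h).D] :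
    (∑ x : (d.graph h).D, if (d.edges.get x.1).beg x.2 = a then (d.edges.get x.1).lam x.2 else 0)
      = (d.edges.map (DEdge.deg a)).sum := by
  have : ∀ k : Fin d.edges.length, Fintype (d.edges.get k).Dir := fun k => Fintype.ofFinite _
  obtain rfl : inst = inferInstanceAs (Fintype (Σ k : Fin d.edges.length, (d.edges.get k).Dir)) :=
    Subsingleton.elim _ _
  refine (Fintype.sum_sigma (fun x : (Σ k : Fin d.edges.length, (d.edges.get k).Dir) =>
    if (d.edges.get x.1).beg x.2 = a then (d.edges.get x.1).lam x.2 else 0)).trans ?_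
  simp_rw [sum_lam_eq_deg]
  rw [← List.sum_ofFn]
  congr 1
  apply List.ext_get <;> simp

theorem Good.isCubic (h : d.Good) : (d.voltageGraph h.valid).cover.IsCubic := by
  rintro ⟨a, i⟩
  let : DecidableEq (d.voltageGraph h.valid).Δ.V := inferInstanceAs (DecidableEq (Fin d.n))
  have : Fintype (d.voltageGraph h.valid).Δ.D :=
    @Fintype.ofFinite _ (d.voltageGraph h.valid).finite_D
  refine (CyclicVoltageGraph.card_darts_cover a i).trans ?_
  exact (sum_lam_graph_eq h.valid.nonempty a (inst := this)).trans (h.degree a)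

theorem linked_edge (h : d.Valid) {e : DEdge d.n} (he : e ∈ d.edges) (s : e.Dir) (t : ℤ) :
    (d.voltageGraph h).cover.Linked ((d.voltageGraph h).vtx (e.beg s) t)
      ((d.voltageGraph h).vtx (e.beg (e.inv s)) (t + e.zeta d.iota s)) := by
  obtain ⟨k, rfl⟩ := List.get_of_mem he
  exact (d.voltageGraph h).linked_vtx ⟨k, s⟩ t

theorem exists_edge_of_linked (h : d.Valid) {p q : (d.voltageGraph h).cover.V}
    (hpq : (d.voltageGraph h).cover.Linked p q) : ∃ e ∈ d.edges, ∃ (s : e.Dir) (t : ℤ),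
      p = (d.voltageGraph h).vtx (e.beg s) t ∧
      q = (d.voltageGraph h).vtx (e.beg (e.inv s)) (t + e.zeta d.iota s) := by
  obtain ⟨⟨k, s⟩, t, hp, hq⟩ := CyclicVoltageGraph.exists_of_linked hpq
  exact ⟨_, d.edges.get_mem k, s, t, hp, hq⟩

theorem zeta_modEq_zero {n N : ℕ} {iota : Fin n → ℕ} {e : DEdge n} (he : N ∣ e.volt iota)
    (s : e.Dir) : e.zeta iota s ≡ 0 [ZMOD N] := by
  cases e with
  | semi a => exact Int.modEq_zero_iff_dvd.2 (Int.natCast_dvd_natCast.2 he)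
  | loop a z =>
    have := Int.natCast_dvd_natCast.2 he
    cases s
    · exact Int.modEq_zero_iff_dvd.2 this
    · exact Int.modEq_zero_iff_dvd.2 this.neg_right
  | link a b p q z =>
    have := Int.natCast_dvd_natCast.2 he
    cases s
    · exact Int.modEq_zero_iff_dvd.2 this
    · exact Int.modEq_zero_iff_dvd.2 this.neg_right

/-- If `N` divides all indices and voltages, the index modulo `N` is well defined on vertices and
constant along walks. A walk from `a_0` to `a_1` then gives `N ∣ 1`. -/
theorem eq_one_of_connected (h : d.Valid) (hc : (d.voltageGraph h).cover.Connected) {N : ℕ}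
    (hN : d.CommonDivisor N) : N = 1 := by
  have key : ∀ p q, Relation.ReflTransGen (d.voltageGraph h).cover.Linked p q → ∀ a s b t,
      p = (d.voltageGraph h).vtx a s → q = (d.voltageGraph h).vtx b t → s ≡ t [ZMOD N] := by
    have hmod : ∀ a b s t, (d.voltageGraph h).vtx a s = (d.voltageGraph h).vtx b t →
        s ≡ t [ZMOD N] := fun a b s t e =>
      (CyclicVoltageGraph.vtx_eq_iff.1 e).2.of_dvd (Int.natCast_dvd_natCast.2 (hN.1 a))
    intro p q hpq
    induction hpq with
    | refl =>
      rintro a s b t rfl e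
      exact hmod _ _ _ _ e
    | tail _ hl ih =>
      intro a s b t e1 e2
      obtain ⟨e, he, x, r, rfl, rfl⟩ := exists_edge_of_linked h hl
      refine (ih a s _ r e1 rfl).trans ?_
      refine Int.ModEq.trans ?_ (hmod _ _ _ _ e2)
      simpa using (zeta_modEq_zero (hN.2 e he) x).symm.add_left r
  obtain ⟨a⟩ := h.nonempty
  have := key _ _ (hc ((d.voltageGraph h).vtx a 0) ((d.voltageGraph h).vtx a 1)) a 0 a 1 rfl rfl
  have := Int.natCast_dvd_natCast.1 (by simpa using this.dvd : (N : ℤ) ∣ ((1 : ℕ) : ℤ))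
  exact Nat.dvd_one.1 this

/-- The shifts `k` for which `c_t` and `c_{t+k}` are always joined by a walk form a subgroup of `ℤ`
containing all indices and voltages. Its generator is a common divisor of these, hence a unit. -/
theorem Good.connected (h : d.Good) (hN : ∀ N, d.CommonDivisor N → N = 1) :
    (d.voltageGraph h.valid).cover.Connected := by
  set C := d.voltageGraph h.valid with hC
  obtain ⟨c, hstar⟩ := h.star
  let R : C.cover.V → C.cover.V → Prop := Relation.ReflTransGen C.cover.Linked
  have hsymm : ∀ {p q}, R p q → R q p := fun hpq =>
    (@Relation.ReflTransGen.stdSymm _ _ ⟨fun _ _ hab => hab.symm⟩).symm _ _ hpq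
  -- The edges of the star have voltage zero, so `c_t` is joined to `a_t` with the same index.
  have hal : ∀ (a : Fin d.n) (t : ℤ), R (C.vtx c t) (C.vtx a t) := by
    intro a t
    rcases hstar a with rfl | ⟨p, q, he | he⟩
    · exact .refl
    · refine .single ?_
      have := linked_edge h.valid he false t
      rw [show t + DEdge.zeta d.iota (.link c a p q 0) false = t from add_zero t] at this
      exact this
    · refine .single ?_
      have := linked_edge h.valid he true t
      rw [show t + DEdge.zeta d.iota (.link a c p q 0) true = t by simp [DEdge.zeta]] at this
      exact this
  let H : AddSubgroup ℤ :=
    { carrier := {k | ∀ t : ℤ, R (C.vtx c t) (C.vtx c (t + k))}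
      zero_mem' := fun t => by rw [add_zero]
      add_mem' := fun {k l} hk hl t => by
        rw [← add_assoc]
        exact (hk t).trans (hl (t + k))
      neg_mem' := fun {k} hk t => by
        have := hsymm (hk (t + -k))
        rwa [neg_add_cancel_right] at this }
  -- The walk is `c_t`, `a_t`, `b_{t+k}`, `c_{t+k}`.
  have hH : ∀ {a b : Fin d.n} {k : ℤ}, (∀ t, R (C.vtx a t) (C.vtx b (t + k))) → k ∈ H :=
    fun {a b k} hab t => ((hal a t).trans (hab t)).trans (hsymm (hal b _))
  -- Here `a_t` and `a_{t+ι(a)}` are the same vertex.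
  have hiota : ∀ a, (d.iota a : ℤ) ∈ H := by
    intro a
    refine hH (a := a) (b := a) fun t => ?_
    have : C.vtx a t = C.vtx a (t + d.iota a) :=
      CyclicVoltageGraph.vtx_eq_iff.2 ⟨rfl, Int.modEq_iff_dvd.2 ⟨1, by
        rw [add_sub_cancel_left, mul_one]; rfl⟩⟩
    rw [← this]
  have hvolt : ∀ e ∈ d.edges, (e.volt d.iota : ℤ) ∈ H := by
    intro e he
    have := fun s => linked_edge h.valid he s
    cases e with
    | semi a => exact hH fun t => .single (this () t)
    | loop a z => exact hH fun t => .single (this false t)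
    | link a b p q z => exact hH fun t => .single (this false t)
  obtain ⟨N, hHN⟩ := Int.subgroup_cyclic H
  rw [← AddSubgroup.zmultiples_eq_closure] at hHN
  have h1 : N.natAbs = 1 := by
    refine hN _ ⟨fun a => ?_, fun e he => ?_⟩
    · have := hiota a
      rw [hHN, Int.mem_zmultiples_iff] at this
      exact Int.natCast_dvd_natCast.1 (Int.natAbs_dvd.2 this)
    · have := hvolt e he
      rw [hHN, Int.mem_zmultiples_iff] at this
      exact Int.natCast_dvd_natCast.1 (Int.natAbs_dvd.2 this)
  have hall : ∀ k : ℤ, k ∈ H := by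
    intro k
    rw [hHN, Int.mem_zmultiples_iff, ← Int.natAbs_dvd, h1]
    simp
  intro p q
  obtain ⟨a, s, rfl⟩ := CyclicVoltageGraph.exists_eq_vtx p
  obtain ⟨b, t, rfl⟩ := CyclicVoltageGraph.exists_eq_vtx q
  have := hall (t - s) s
  rw [add_sub_cancel] at this
  exact ((hsymm (hal a s)).trans this).trans (hal b t)

end Diagram

/-! ### Explicit forms of the edge conditions. -/

namespace DEdge

section apart

variable {n : ℕ} {a b a' b' : Fin n} {p q z p' q' z' : ℕ}

theorem volt_semi {iota : Fin n → ℕ} : volt iota (.semi a) = iota a / 2 := rfl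

theorem volt_loop {iota : Fin n → ℕ} : volt iota (.loop a z) = z := rfl

theorem volt_link {iota : Fin n → ℕ} : volt iota (.link a b p q z) = z := rfl

@[simp] theorem reduced_semi {iota : Fin n → ℕ} : Reduced iota (.semi a) := trivial

@[simp] theorem reduced_loop {iota : Fin n → ℕ} :
    Reduced iota (.loop a z) ↔ 0 < z ∧ z < iota a ∧ 2 * z ≠ iota a := Iff.rfl

@[simp] theorem reduced_link {iota : Fin n → ℕ} :
    Reduced iota (.link a b p q z) ↔ z < Nat.gcd (iota a) (iota b) := Iff.rfl

theorem apart_semi_semi : Apart (.semi a) (.semi a') ↔ a ≠ a' := Iff.rfl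

theorem apart_loop_loop : Apart (.loop a z) (.loop a' z') ↔ a ≠ a' := Iff.rfl

theorem apart_link_link : Apart (.link a b p q z) (.link a' b' p' q' z') ↔
    (a = a' → b = b' → z ≠ z') ∧ ¬ (a = b' ∧ b = a') := Iff.rfl

theorem apart_semi_loop : Apart (.semi a) (.loop a' z') := trivial

theorem apart_loop_semi : Apart (.loop a z) (.semi a') := trivial

theorem apart_link_semi : Apart (.link a b p q z) (.semi a') := trivial

theorem apart_link_loop : Apart (.link a b p q z) (.loop a' z') := trivial

theorem isProper_semi : IsProper (.semi a) := trivial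

theorem isProper_loop : IsProper (.loop a z) := trivial

theorem isProper_link : IsProper (.link a b p q z) ↔ a ≠ b ∧ Nat.gcd p q = 1 := Iff.rfl

theorem valid_semi {iota : Fin n → ℕ} : Valid iota (.semi a) ↔ iota a % 2 = 0 := Nat.even_iff

theorem valid_loop {iota : Fin n → ℕ} : Valid iota (.loop a z) := trivial

theorem valid_link {iota : Fin n → ℕ} : Valid iota (.link a b p q z) ↔
    0 < p ∧ 0 < q ∧ p * iota a = q * iota b := Iff.rfl

end apart

end DEdge

/-! ### Checklists for diagrams with one, two and three vertices. -/

namespace Diagram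

theorem good_one {a : ℕ} {es : List (DEdge 1)} (ha : 0 < a) (hr : Reduced ⟨1, ![a], es⟩)
    (hv : es.Forall (DEdge.Valid ![a])) (hp : es.Forall DEdge.IsProper)
    (hapart : es.Pairwise DEdge.Apart) (hdeg : (es.map (DEdge.deg 0)).sum = 3) :
    Good ⟨1, ![a], es⟩ where
  valid := valid_one ha hv
  reduced := hr
  proper := List.forall_iff_forall_mem.1 hp
  apart := hapart
  degree := fun i => match i with
    | 0 => hdeg
  star := ⟨(0 : Fin 1), fun i => Or.inl (Subsingleton.elim (α := Fin 1) i 0)⟩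

theorem good_two {a b p q : ℕ} {es : List (DEdge 2)} (ha : 0 < a) (hb : 0 < b)
    (hr : Reduced ⟨2, ![a, b], .link 0 1 p q 0 :: es⟩)
    (hv : (.link 0 1 p q 0 :: es : List (DEdge 2)).Forall (DEdge.Valid ![a, b]))
    (hp : (.link 0 1 p q 0 :: es : List (DEdge 2)).Forall DEdge.IsProper)
    (hapart : (.link 0 1 p q 0 :: es : List (DEdge 2)).Pairwise DEdge.Apart)
    (hdeg : ∀ i, ((.link 0 1 p q 0 :: es : List (DEdge 2)).map (DEdge.deg i)).sum = 3) :
    Good ⟨2, ![a, b], .link 0 1 p q 0 :: es⟩ where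
  valid := valid_two ha hb hv
  reduced := hr
  proper := List.forall_iff_forall_mem.1 hp
  apart := hapart
  degree := hdeg
  star := ⟨(0 : Fin 2), fun i => match i with
    | 0 => Or.inl rfl
    | 1 => Or.inr ⟨p, q, Or.inl List.mem_cons_self⟩⟩

theorem good_three {a b c p q p' q' : ℕ} {es : List (DEdge 3)}
    (ha : 0 < a) (hb : 0 < b) (hc : 0 < c)
    (hr : Reduced ⟨3, ![a, b, c], .link 0 1 p q 0 :: .link 1 2 p' q' 0 :: es⟩)
    (hv : (.link 0 1 p q 0 :: .link 1 2 p' q' 0 :: es : List (DEdge 3)).Forall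
      (DEdge.Valid ![a, b, c]))
    (hp : (.link 0 1 p q 0 :: .link 1 2 p' q' 0 :: es : List (DEdge 3)).Forall DEdge.IsProper)
    (hapart : (.link 0 1 p q 0 :: .link 1 2 p' q' 0 :: es : List (DEdge 3)).Pairwise DEdge.Apart)
    (hdeg : ∀ i, ((.link 0 1 p q 0 :: .link 1 2 p' q' 0 :: es : List (DEdge 3)).map
      (DEdge.deg i)).sum = 3) :
    Good ⟨3, ![a, b, c], .link 0 1 p q 0 :: .link 1 2 p' q' 0 :: es⟩ where
  valid := valid_three ha hb hc hv
  reduced := hr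
  proper := List.forall_iff_forall_mem.1 hp
  apart := hapart
  degree := hdeg
  star := ⟨(1 : Fin 3), fun i => match i with
    | 0 => Or.inr ⟨p, q, Or.inr List.mem_cons_self⟩
    | 1 => Or.inl rfl
    | 2 => Or.inr ⟨p', q', Or.inl (List.mem_cons_of_mem _ List.mem_cons_self)⟩⟩

theorem good_three' {a b c p q p' q' : ℕ} {es : List (DEdge 3)}
    (ha : 0 < a) (hb : 0 < b) (hc : 0 < c)
    (hr : Reduced ⟨3, ![a, b, c], .link 0 2 p q 0 :: .link 1 2 p' q' 0 :: es⟩)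
    (hv : (.link 0 2 p q 0 :: .link 1 2 p' q' 0 :: es : List (DEdge 3)).Forall
      (DEdge.Valid ![a, b, c]))
    (hp : (.link 0 2 p q 0 :: .link 1 2 p' q' 0 :: es : List (DEdge 3)).Forall DEdge.IsProper)
    (hapart : (.link 0 2 p q 0 :: .link 1 2 p' q' 0 :: es : List (DEdge 3)).Pairwise DEdge.Apart)
    (hdeg : ∀ i, ((.link 0 2 p q 0 :: .link 1 2 p' q' 0 :: es : List (DEdge 3)).map
      (DEdge.deg i)).sum = 3) :
    Good ⟨3, ![a, b, c], .link 0 2 p q 0 :: .link 1 2 p' q' 0 :: es⟩ where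
  valid := valid_three' ha hb hc hv
  reduced := hr
  proper := List.forall_iff_forall_mem.1 hp
  apart := hapart
  degree := hdeg
  star := ⟨(2 : Fin 3), fun i => match i with
    | 0 => Or.inr ⟨p, q, Or.inr List.mem_cons_self⟩
    | 1 => Or.inr ⟨p', q', Or.inr (List.mem_cons_of_mem _ List.mem_cons_self)⟩
    | 2 => Or.inl rfl⟩

theorem reduced_iff_forall {n : ℕ} {iota : Fin n → ℕ} {es : List (DEdge n)} :
    Reduced ⟨n, iota, es⟩ ↔ es.Forall (DEdge.Reduced iota) := by
  rw [List.forall_iff_forall_mem]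
  rfl

theorem commonDivisor_one {a N : ℕ} {es : List (DEdge 1)} :
    CommonDivisor ⟨1, ![a], es⟩ N ↔ N ∣ a ∧ es.Forall fun e => N ∣ e.volt ![a] := by
  simp [CommonDivisor, List.forall_iff_forall_mem]

theorem commonDivisor_two {a b N : ℕ} {es : List (DEdge 2)} :
    CommonDivisor ⟨2, ![a, b], es⟩ N ↔
      (N ∣ a ∧ N ∣ b) ∧ es.Forall fun e => N ∣ e.volt ![a, b] := by
  simp [CommonDivisor, List.forall_iff_forall_mem, Fin.forall_fin_succ]

theorem commonDivisor_three {a b c N : ℕ} {es : List (DEdge 3)} :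
    CommonDivisor ⟨3, ![a, b, c], es⟩ N ↔
      (N ∣ a ∧ N ∣ b ∧ N ∣ c) ∧ es.Forall fun e => N ∣ e.volt ![a, b, c] := by
  simp [CommonDivisor, List.forall_iff_forall_mem, Fin.forall_fin_succ]

end Diagram

/-! ### Local conditions on the parameters, and the listed ones. -/

/-- The conditions on the parameters of the `i`-th diagram under which its cover is cubic and
simple, but possibly disconnected. -/
def LocalConditions (i m r s : ℕ) : Prop :=
  match i with
  | 7 | 9 | 10 => 4 ∣ m
  | 11 => 8 ∣ m
  | 15 => 6 ∣ m
  | 16 | 2 | 6 | 8 | 17 | 19 => True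
  | 1 | 5 | 12 | 13 | 14 | 18 | 24 | 25 => Even m
  | 3 | 20 | 21 | 22 => Even m ∧ r ≠ 0
  | 4 => 0 < r ∧ r < s
  | 23 => Even m ∧ r ≠ s
  | _ => False

/-- The parameters give a cubic simple cover. -/
structure LocallyAdmissible (i m r s : ℕ) : Prop where
  pos : 0 < m
  conditions : LocalConditions i m r s
  reduced : (diagram i m r s).Reduced

set_option linter.unusedSimpArgs false in
theorem LocallyAdmissible.good {i m r s : ℕ} (h : LocallyAdmissible i m r s) :
    (diagram i m r s).Good := by
  obtain ⟨hm, hc, hr⟩ := h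
  unfold LocalConditions at hc
  split at hc
  all_goals first
    | exact hc.elim
    | first
      | refine Diagram.good_one ?_ hr ?_ ?_ ?_ ?_
      | refine Diagram.good_two ?_ ?_ hr ?_ ?_ ?_ ?_
      | refine Diagram.good_three ?_ ?_ ?_ hr ?_ ?_ ?_ ?_
      | refine Diagram.good_three' ?_ ?_ ?_ hr ?_ ?_ ?_ ?_
  all_goals
    clear hr
    try simp only [Nat.even_iff] at hc
    first
    | omega
    | (intro i; fin_cases i <;> rfl)
    | rfl
    | (simp [DEdge.isProper_semi, DEdge.isProper_loop, DEdge.isProper_link]; done)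
    | (simp [DEdge.valid_semi, DEdge.valid_loop, DEdge.valid_link]; done)
    | (simp [DEdge.valid_semi, DEdge.valid_loop, DEdge.valid_link]; omega)
    | (simp [DEdge.apart_semi_semi, DEdge.apart_loop_loop, DEdge.apart_link_link,
        DEdge.apart_semi_loop, DEdge.apart_loop_semi, DEdge.apart_link_semi, DEdge.apart_link_loop]; done)
    | (simp [DEdge.apart_semi_semi, DEdge.apart_loop_loop, DEdge.apart_link_link,
        DEdge.apart_semi_loop, DEdge.apart_loop_semi, DEdge.apart_link_semi, DEdge.apart_link_loop]; omega)

theorem Admissible.locallyAdmissible {i m r s : ℕ} (h : Admissible i m r s) :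
    LocallyAdmissible i m r s := by
  refine ⟨h.pos, ?_, h.reduced⟩
  obtain ⟨-, hc, -⟩ := h
  unfold ParameterConditions at hc
  split at hc
  all_goals first
    | exact hc.elim
    | exact trivial
    | exact hc.1
    | exact ⟨hc.1, hc.2.1⟩
    | exact ⟨hc.1, hc.2.2.1⟩
    | exact ⟨hc.2.1, hc.2.2.1⟩
    | (subst hc; simp [LocalConditions])

set_option linter.unusedSimpArgs false in
-- The listed gcd conditions are the connectedness criterion, evaluated diagram by diagram.
theorem Admissible.eq_one {i m r s : ℕ} (h : Admissible i m r s) {N : ℕ}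
    (hN : (diagram i m r s).CommonDivisor N) : N = 1 := by
  obtain ⟨-, hc, -⟩ := h
  have key : ∀ {k : ℕ}, Nat.gcd k (Nat.gcd r s) = 1 → N ∣ k → N ∣ r → N ∣ s → N = 1 :=
    fun h hk hr hs => Nat.dvd_one.1 (h ▸ Nat.dvd_gcd hk (Nat.dvd_gcd hr hs))
  have key' : ∀ {k : ℕ}, Nat.gcd k r = 1 → N ∣ k → N ∣ r → N = 1 :=
    fun h hk hr => Nat.dvd_one.1 (h ▸ Nat.dvd_gcd hk hr)
  have hcop : ∀ a b : ℕ, N ∣ a → N ∣ b → Nat.gcd a b = 1 → N = 1 :=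
    fun a b ha hb h => Nat.dvd_one.1 (h ▸ Nat.dvd_gcd ha hb)
  -- The number `3m/2` is a voltage in diagrams 13 and 20 and an index in diagram 14.
  have hsub : Even m → N ∣ m → N ∣ 3 * m / 2 → N ∣ m / 2 := by
    rintro hm ha hb
    rw [Nat.even_iff] at hm
    rw [show 3 * m / 2 = m + m / 2 by omega] at hb
    exact (Nat.dvd_add_right ha).1 hb
  unfold ParameterConditions at hc
  split at hc
  all_goals first
    | exact hc.elim
    | replace hN := Diagram.commonDivisor_one.1 hN
    | replace hN := Diagram.commonDivisor_two.1 hN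
    | replace hN := Diagram.commonDivisor_three.1 hN
  all_goals simp [DEdge.volt_semi, DEdge.volt_loop, DEdge.volt_link] at hN
  all_goals first
    | exact key hc.2.2.2 (k := m) (by tauto) (by tauto) (by tauto)
    | exact key hc.2.2 (k := m / 2) (by tauto) (by tauto) (by tauto)
    | exact key hc.2.2.2.2 (k := m / 2) (by tauto) (by tauto) (by tauto)
    | exact key' hc (k := m) (by tauto) (by tauto)
    | exact key' hc.2 (k := m) (by tauto) (by tauto)
    | exact key' hc.2 (k := m / 2) (by tauto) (by tauto)
    | exact key' hc.2.2 (k := m / 2) (by tauto) (by tauto)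
    | exact key' hc.2.2.2 (k := m / 2) (by tauto) (by tauto)
    -- In each sporadic graph some index or voltage is 1, or two of them are coprime: 3 and 4, 3 and
    -- 8, or 2 and 3.
    | (subst hc
       simp only [Nat.reduceMul, Nat.reduceDiv] at hN
       first
       | exact hcop 1 1 (by tauto) (by tauto) rfl
       | exact hcop 3 4 (by tauto) (by tauto) rfl
       | exact hcop 3 8 (by tauto) (by tauto) rfl
       | exact hcop 2 3 (by tauto) (by tauto) rfl)

/-- The factors cover the ratios of the indices and voltages to the divisors tried below; for
diagram 11 and `k = m / 8` they are 8, 12, 6 and 3. -/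
theorem dvd_of_eq_small_mul {N k x : ℕ} (h : N ∣ k) (hx : x = k ∨ x = k * 2 ∨ x = k * 3 ∨
    x = k * 4 ∨ x = k * 6 ∨ x = k * 8 ∨ x = k * 12) : N ∣ x := by
  rcases hx with rfl | rfl | rfl | rfl | rfl | rfl | rfl
  · exact h
  all_goals exact h.mul_right _

set_option linter.unusedSimpArgs false in
-- Feeding the gcd in question to the connectedness criterion shows that it is 1. The bounds on `m`
-- and the nonzero loop voltages come from reducedness: `0 < z < ι` and `2 z ≠ ι` force `ι ≥ 3`, and
-- so `ι ≥ 4` if `ι` is even.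
theorem LocallyAdmissible.admissible {i m r s : ℕ} (h : LocallyAdmissible i m r s)
    (hN : ∀ N, (diagram i m r s).CommonDivisor N → N = 1) : Admissible i m r s := by
  obtain ⟨hm, hc, hr⟩ := h
  refine ⟨hm, ?_, hr⟩
  unfold LocalConditions at hc
  split at hc
  all_goals first
    | exact hc.elim
    | replace hN := fun N h => hN N (Diagram.commonDivisor_one.2 h)
    | replace hN := fun N h => hN N (Diagram.commonDivisor_two.2 h)
    | replace hN := fun N h => hN N (Diagram.commonDivisor_three.2 h)
  all_goals
    replace hr := Diagram.reduced_iff_forall.1 hr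
    simp [DEdge.reduced_semi, DEdge.reduced_loop, DEdge.reduced_link] at hr
    simp [DEdge.volt_semi, DEdge.volt_loop, DEdge.volt_link] at hN
    simp only [ParameterConditions]
    try simp only [Nat.even_iff] at hc ⊢
    repeat' apply And.intro
  all_goals try omega
  -- For the sporadic diagrams the fixed fraction `m / 8`, `m / 6` or `m / 4` divides all indices
  -- and voltages, so it equals 1.
  all_goals first
    | suffices h : m / 8 = 1 by omega
    | suffices h : m / 6 = 1 by omega
    | suffices h : m / 4 = 1 by omega
    | skip
  all_goals
    apply hN
    all_goals first
    | exact dvd_of_eq_small_mul dvd_rfl (by omega)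
    | exact Nat.gcd_dvd_right _ _
    | exact (Nat.gcd_dvd_right _ _).trans (Nat.gcd_dvd_left _ _)
    | exact (Nat.gcd_dvd_right _ _).trans (Nat.gcd_dvd_right _ _)
    | exact dvd_of_eq_small_mul (Nat.gcd_dvd_left _ _) (by omega)

/-- The graphs in the list are connected. -/
theorem Admissible.connected {i m r s : ℕ} (h : Admissible i m r s) :
    (gammaGraph i m r s h).Connected :=
  h.locallyAdmissible.good.connected fun _ => h.eq_one

theorem Admissible.isCubic {i m r s : ℕ} (h : Admissible i m r s) :
    (gammaGraph i m r s h).IsCubic := h.locallyAdmissible.good.isCubic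

theorem Admissible.isSimple {i m r s : ℕ} (h : Admissible i m r s) :
    (gammaGraph i m r s h).IsSimple := h.locallyAdmissible.good.isSimple

theorem Admissible.n_le {i m r s : ℕ} (h : Admissible i m r s) : (diagram i m r s).n ≤ 3 := by
  unfold diagram
  split <;> simp

/-! ### Every listed graph has a cyclic group with at most three orbits. -/

namespace DartGraph

/-- The group is generated by the conjugate of the shift; the vertices `a_0` represent its orbits,
one for each vertex of the diagram. -/
theorem exists_cyclic_of_iso {Γ : DartGraph.{u, v}} {i m r s : ℕ} (h : Admissible i m r s)
    (φ : Γ.Iso (gammaGraph i m r s h)) :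
    Finite Γ.V ∧ Γ.Connected ∧ Γ.IsCubic ∧ Γ.IsSimple ∧
      ∃ G : Subgroup Γ.Aut, IsCyclic G ∧ Nat.card (MulAction.orbitRel.Quotient G Γ.V) ≤ 3 := by
  let C := (diagram i m r s).voltageGraph (diagram_valid h)
  have : Finite (gammaGraph i m r s h).V := inferInstanceAs (Finite C.cover.V)
  refine ⟨Finite.of_equiv _ φ.onV.symm, φ.symm.connected h.connected, φ.symm.isCubic h.isCubic,
    φ.symm.isSimple h.isSimple, Subgroup.zpowers (φ.symm.conj C.shift), inferInstance, ?_⟩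
  refine (card_orbits_le _ (fun a : Fin (diagram i m r s).n => φ.onV.symm (C.vtx a 0)) ?_).trans ?_
  · intro b
    obtain ⟨a, t, hb⟩ := CyclicVoltageGraph.exists_eq_vtx (C := C) (φ.onV b)
    refine ⟨a, t, ?_⟩
    refine (φ.symm.conj_zpow_smul C.shift t (C.vtx a 0)).trans ?_
    exact (congrArg φ.onV.symm (CyclicVoltageGraph.shift_zpow_smul (C := C) a t)).trans
      ((Equiv.symm_apply_eq _).2 hb.symm)
  · rw [Nat.card_fin]
    exact h.n_le

end DartGraph

/-! ### Recovering a graph from one automorphism: orbits, exponents and degrees. -/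

namespace DartGraph

open Finset

variable {Γ : DartGraph.{u, v}} {p : Γ.Aut} {a b c x y z : Γ.V}

theorem linked_zpow_smul (k : ℤ) : Γ.Linked (p ^ k • a) (p ^ k • b) ↔ Γ.Linked a b :=
  Aut.linked_iff (p ^ k) a b

/-- The edge of a drawn diagram is present in the graph when `w a` is the vertex `a_0`. -/
def Realises {n : ℕ} (p : Γ.Aut) (w : Fin n → Γ.V) (iota : Fin n → ℕ) : DEdge n → Prop
  | .semi a => Γ.Linked (w a) (p ^ (iota a / 2) • w a)
  | .loop a z => Γ.Linked (w a) (p ^ z • w a)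
  | .link a b _ _ z => Γ.Linked (w a) (p ^ z • w b)

/-- One edge yields its translates under the powers of `p`, and these are the images of all lifts of
the diagram edge, in both directions. -/
theorem Realises.linked {n : ℕ} {w : Fin n → Γ.V} {iota : Fin n → ℕ} {e : DEdge n}
    (h : Realises p w iota e) (s : e.Dir) (t : ℤ) :
    Γ.Linked (p ^ t • w (e.beg s)) (p ^ (t + e.zeta iota s) • w (e.beg (e.inv s))) := by
  have hback : ∀ {a b : Γ.V} {z : ℕ}, Γ.Linked a (p ^ z • b) →
      Γ.Linked (p ^ t • b) (p ^ (t + -(z : ℤ)) • a) := fun {a b z} h => by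
    rw [← linked_zpow_smul (p := p) (z - t), smul_smul, smul_smul, ← zpow_add, ← zpow_add,
      sub_add_cancel, show (z : ℤ) - t + (t + -z) = 0 by ring, zpow_zero, one_smul, zpow_natCast]
    exact h.symm
  have hforw : ∀ {a b : Γ.V} {z : ℕ}, Γ.Linked a (p ^ z • b) →
      Γ.Linked (p ^ t • a) (p ^ (t + (z : ℤ)) • b) := fun {a b z} h => by
    rw [zpow_add, mul_smul, linked_zpow_smul, zpow_natCast]
    exact h
  cases e with
  | semi a => exact hforw h
  | loop a z =>
    cases s
    · exact hforw h
    · exact hback h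
  | link a b _ _ z =>
    cases s
    · exact hforw h
    · exact hback h

theorem nonempty_iso_cover (hs : Γ.IsSimple) (hc : Γ.IsCubic) {d : Diagram} (hd : d.Good)
    (w : Fin d.n → Γ.V) (hper : ∀ a, MulAction.period p (w a) = d.iota a)
    (horb : ∀ a b, ∀ k : ℤ, p ^ k • w a = w b → a = b)
    (hall : ∀ v, ∃ a, ∃ k : ℤ, p ^ k • w a = v)
    (hedge : ∀ e ∈ d.edges, Realises p w d.iota e) :
    Nonempty (Γ.Iso (d.voltageGraph hd.valid).cover) := by
  set C := d.voltageGraph hd.valid with hC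
  -- This is `a_t ↦ p ^ t • w a`, with the residue represented by an integer; `hF` shows that the
  -- choice is immaterial.
  let F : C.cover.V → Γ.V := fun q => p ^ ((q.2 : ZMod (C.iota q.1)).cast : ℤ) • w q.1
  have hmod : ∀ (a : Fin d.n) (s t : ℤ), p ^ s • w a = p ^ t • w a ↔ s ≡ t [ZMOD d.iota a] := by
    intro a s t
    rw [Int.modEq_comm, Int.modEq_iff_dvd, ← hper, ← MulAction.zpow_smul_eq_iff_period_dvd,
      sub_eq_neg_add, zpow_add, mul_smul, zpow_neg, inv_smul_eq_iff]
  have hF : ∀ (a : Fin d.n) (t : ℤ), F (C.vtx a t) = p ^ t • w a := by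
    intro a t
    refine (hmod a _ _).2 ?_
    rw [← ZMod.intCast_eq_intCast_iff]
    exact ZMod.intCast_zmod_cast _
  have hbij : Function.Bijective F := by
    constructor
    · intro q q' h
      obtain ⟨a, s, rfl⟩ := CyclicVoltageGraph.exists_eq_vtx q
      obtain ⟨b, t, rfl⟩ := CyclicVoltageGraph.exists_eq_vtx q'
      have h' : p ^ s • w a = p ^ t • w b := (hF a s).symm.trans (h.trans (hF b t))
      have e : a = b := by
        refine horb a b (-t + s) ?_
        rw [zpow_add, mul_smul, zpow_neg, inv_smul_eq_iff]
        exact h'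
      subst e
      exact CyclicVoltageGraph.vtx_eq_iff.2 ⟨rfl, (hmod a s t).1 h'⟩
    · intro v
      obtain ⟨a, k, rfl⟩ := hall v
      exact ⟨C.vtx a k, hF a k⟩
  have hlink : ∀ q q', C.cover.Linked q q' → Γ.Linked (F q) (F q') := by
    intro q q' h
    obtain ⟨e, he, s, t, rfl, rfl⟩ := Diagram.exists_edge_of_linked hd.valid h
    have := (hedge e he).linked s t
    rwa [← hF, ← hF] at this
  -- The injection from the three neighbours of `q` to the three neighbours of `F q` is onto, so `F`
  -- creates no adjacency that is not already in the cover.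
  have hlink' : ∀ q q', Γ.Linked (F q) (F q') → C.cover.Linked q q' := by
    intro q q' h
    have h3 := card_linked hd.isSimple hd.isCubic q
    have h3' := card_linked hs hc (F q)
    have : Finite {v // Γ.Linked (F q) v} :=
      Nat.finite_of_card_ne_zero fun h0 => by simp [h0] at h3'
    have : Finite {q' // C.cover.Linked q q'} :=
      Nat.finite_of_card_ne_zero fun h0 => by
        have := h0.symm.trans h3
        omega
    let G : {q' // C.cover.Linked q q'} → {v // Γ.Linked (F q) v} :=
      fun q' => ⟨F q'.1, hlink _ _ q'.2⟩
    have hG : Function.Injective G := fun q₁ q₂ h =>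
      Subtype.ext (hbij.1 (congrArg Subtype.val h))
    have hG' := ((Nat.bijective_iff_injective_and_card G).2 ⟨hG, h3.trans h3'.symm⟩).2
    obtain ⟨q'', h''⟩ := hG' ⟨F q', h⟩
    have := hbij.1 (congrArg Subtype.val h'')
    rw [← this]
    exact q''.2
  obtain ⟨φ⟩ := nonempty_iso_of_linked hd.isSimple hs (Equiv.ofBijective F hbij)
    fun q q' => ⟨hlink q q', hlink' q q'⟩
  exact ⟨φ.symm⟩

variable (Γ) in
/-- The graph is isomorphic to one of the graphs in the list. -/
def IsListed : Prop :=
  ∃ i m r s : ℕ, ∃ h : Admissible i m r s, Nonempty (Γ.Iso (gammaGraph i m r s h))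

/-- Only local conditions have to be checked: connectedness of `Γ` passes to the cover and supplies
the gcd conditions. -/
theorem isListed_of_realises (hs : Γ.IsSimple) (hc : Γ.IsCubic) (hconn : Γ.Connected)
    {i m r s : ℕ} (hd : LocallyAdmissible i m r s)
    (w : Fin (diagram i m r s).n → Γ.V)
    (hper : ∀ a, MulAction.period p (w a) = (diagram i m r s).iota a)
    (horb : ∀ a b, ∀ k : ℤ, p ^ k • w a = w b → a = b)
    (hall : ∀ v, ∃ a, ∃ k : ℤ, p ^ k • w a = v)
    (hedge : ∀ e ∈ (diagram i m r s).edges, Realises p w (diagram i m r s).iota e) :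
    Γ.IsListed := by
  obtain ⟨φ⟩ := nonempty_iso_cover hs hc hd.good w hper horb hall hedge
  have hA := hd.admissible fun N => Diagram.eq_one_of_connected hd.good.valid (φ.connected hconn)
  exact ⟨i, m, r, s, hA, ⟨φ⟩⟩

/-- Two vertices in the same orbit of the cyclic group generated by `p`. -/
def SameOrbit (p : Γ.Aut) (a b : Γ.V) : Prop := ∃ k : ℤ, p ^ k • a = b

theorem SameOrbit.refl (p : Γ.Aut) (a : Γ.V) : SameOrbit p a a := ⟨0, by simp⟩

theorem SameOrbit.symm (h : SameOrbit p a b) : SameOrbit p b a := by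
  obtain ⟨k, rfl⟩ := h
  exact ⟨-k, by simp⟩

theorem SameOrbit.trans (h : SameOrbit p a b) (h' : SameOrbit p b c) : SameOrbit p a c := by
  obtain ⟨k, rfl⟩ := h
  obtain ⟨l, rfl⟩ := h'
  exact ⟨l + k, by rw [zpow_add, mul_smul]⟩

theorem sameOrbit_zpow_smul (k : ℤ) : SameOrbit p a (p ^ k • a) := ⟨k, rfl⟩

theorem period_pos [Finite Γ.V] (p : Γ.Aut) (a : Γ.V) : 0 < MulAction.period p a := by
  have hinj : Function.Injective (p • · : Γ.V → Γ.V) := MulAction.injective p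
  exact Function.minimalPeriod_pos_iff_mem_periodicPts.2 (hinj.mem_periodicPts a)

theorem SameOrbit.period_eq (h : SameOrbit p a b) :
    MulAction.period p a = MulAction.period p b := by
  obtain ⟨k, rfl⟩ := h
  have hdvd : ∀ n : ℕ, MulAction.period p a ∣ n ↔ MulAction.period p (p ^ k • a) ∣ n := by
    intro n
    rw [← MulAction.pow_smul_eq_iff_period_dvd, ← MulAction.pow_smul_eq_iff_period_dvd,
      smul_smul, ← zpow_natCast, ← zpow_add, add_comm, zpow_add, mul_smul,
      smul_left_cancel_iff]
  exact Nat.dvd_antisymm ((hdvd _).2 dvd_rfl) ((hdvd _).1 dvd_rfl)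

theorem exists_lt_period [Finite Γ.V] (h : SameOrbit p a b) :
    ∃ z < MulAction.period p a, p ^ z • a = b := by
  obtain ⟨k, rfl⟩ := h
  have hpos := period_pos p a
  have h0 := Int.emod_nonneg k (b := MulAction.period p a) (by omega)
  have h1 := Int.emod_lt_of_pos k (b := MulAction.period p a) (by omega)
  refine ⟨(k % MulAction.period p a).toNat, by omega, ?_⟩
  rw [← zpow_natCast, Int.toNat_of_nonneg h0]
  conv_rhs => rw [← Int.emod_add_mul_ediv k (MulAction.period p a), zpow_add, mul_smul]
  congr 1
  exact (MulAction.zpow_smul_eq_iff_period_dvd.2 (dvd_mul_right _ _)).symm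

theorem pow_smul_inj {i j : ℕ} (hi : i < MulAction.period p a) (hj : j < MulAction.period p a)
    (h : p ^ i • a = p ^ j • a) : i = j := by
  wlog hij : i ≤ j generalizing i j
  · exact (this hj hi h.symm (by omega)).symm
  obtain ⟨k, rfl⟩ := Nat.exists_eq_add_of_le hij
  rw [pow_add, mul_smul, smul_left_cancel_iff, eq_comm,
    MulAction.pow_smul_eq_iff_period_dvd] at h
  have := Nat.eq_zero_of_dvd_of_lt h (by omega)
  omega

open Classical in
/-- The exponents `z`, reduced modulo the length of the orbit of `b`, such that `a` is adjacent
to the image of `b` under the `z`-th power of the automorphism. -/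
noncomputable def residues (p : Γ.Aut) (a b : Γ.V) : Finset ℕ :=
  (range (MulAction.period p b)).filter fun z => Γ.Linked a (p ^ z • b)

theorem mem_residues {n : ℕ} :
    n ∈ residues p a b ↔ n < MulAction.period p b ∧ Γ.Linked a (p ^ n • b) := by
  simp [residues]

/-- The number of neighbours of `a` in the orbit of `b`. -/
noncomputable def orbitDegree (p : Γ.Aut) (a b : Γ.V) : ℕ := #(residues p a b)

section Fintype

variable [Fintype Γ.V]

open Classical in
-- Counting neighbours instead of exponents makes it visible that the number depends only on the
-- orbits of `a` and `b`.
theorem orbitDegree_eq (p : Γ.Aut) (a b : Γ.V) :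
    orbitDegree p a b = #{v ∈ univ.filter (SameOrbit p b) | Γ.Linked a v} := by
  refine card_bij (fun n _ => p ^ n • b) ?_ ?_ ?_
  · intro n hn
    rw [mem_residues] at hn
    simp only [mem_filter, mem_univ, true_and]
    exact ⟨⟨n, by rw [zpow_natCast]⟩, hn.2⟩
  · intro i hi j hj h
    exact pow_smul_inj (mem_residues.1 hi).1 (mem_residues.1 hj).1 h
  · intro v hv
    simp only [mem_filter, mem_univ, true_and] at hv
    obtain ⟨n, hn, rfl⟩ := exists_lt_period hv.1
    exact ⟨n, mem_residues.2 ⟨hn, hv.2⟩, rfl⟩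

open Classical in
theorem card_orbit (p : Γ.Aut) (a : Γ.V) :
    #(univ.filter (SameOrbit p a)) = MulAction.period p a := by
  rw [← card_range (MulAction.period p a)]
  symm
  refine card_bij (fun n _ => p ^ n • a) ?_ ?_ ?_
  · intro n _
    simp only [mem_filter, mem_univ, true_and]
    exact ⟨n, by rw [zpow_natCast]⟩
  · intro i hi j hj h
    exact pow_smul_inj (mem_range.1 hi) (mem_range.1 hj) h
  · intro v hv
    simp only [mem_filter, mem_univ, true_and] at hv
    obtain ⟨n, hn, rfl⟩ := exists_lt_period hv
    exact ⟨n, mem_range.2 hn, rfl⟩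

theorem orbitDegree_congr_right (h : SameOrbit p b c) :
    orbitDegree p a b = orbitDegree p a c := by
  classical
  rw [orbitDegree_eq, orbitDegree_eq]
  congr 2
  ext v
  simp only [mem_filter, mem_univ, true_and]
  exact ⟨fun h' => h.symm.trans h', fun h' => h.trans h'⟩

theorem orbitDegree_congr_left (h : SameOrbit p a b) :
    orbitDegree p a c = orbitDegree p b c := by
  classical
  rw [orbitDegree_eq, orbitDegree_eq]
  obtain ⟨k, rfl⟩ := h
  refine card_bij (fun v _ => p ^ k • v) ?_ ?_ ?_
  · intro v hv
    simp only [mem_filter, mem_univ, true_and] at hv ⊢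
    exact ⟨hv.1.trans (sameOrbit_zpow_smul k), (linked_zpow_smul k).2 hv.2⟩
  · intro i _ j _ h
    exact smul_left_cancel _ h
  · intro v hv
    simp only [mem_filter, mem_univ, true_and] at hv
    refine ⟨p ^ (-k) • v, ?_, by simp⟩
    simp only [mem_filter, mem_univ, true_and]
    refine ⟨hv.1.trans (sameOrbit_zpow_smul _), ?_⟩
    rw [← linked_zpow_smul (p := p) k, smul_smul, ← zpow_add, add_neg_cancel, zpow_zero, one_smul]
    exact hv.2

/-- Double counting of the adjacent pairs between the two orbits. -/
theorem orbitDegree_mul_period (p : Γ.Aut) (a b : Γ.V) :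
    orbitDegree p a b * MulAction.period p a = orbitDegree p b a * MulAction.period p b := by
  classical
  rw [← card_orbit p a, ← card_orbit p b, mul_comm, mul_comm (orbitDegree p b a)]
  refine card_mul_eq_card_mul Γ.Linked (fun v hv => ?_) (fun v hv => ?_)
  · simp only [mem_filter, mem_univ, true_and] at hv
    rw [orbitDegree_congr_left hv, orbitDegree_eq]
    rfl
  · simp only [mem_filter, mem_univ, true_and] at hv
    rw [orbitDegree_congr_left hv, orbitDegree_eq]
    congr 1
    ext u
    simp only [mem_bipartiteBelow, mem_filter, mem_univ, true_and]
    exact and_congr_right fun _ => ⟨Linked.symm, Linked.symm⟩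

open Classical in
theorem card_filter_linked (hs : Γ.IsSimple) (hc : Γ.IsCubic) (a : Γ.V) :
    #{v | Γ.Linked a v} = 3 := by
  rw [← card_linked hs hc a, Nat.card_eq_fintype_card, Fintype.card_subtype]

theorem sum_orbitDegree_one (hs : Γ.IsSimple) (hc : Γ.IsCubic) (hall : ∀ v, SameOrbit p x v)
    (a : Γ.V) : orbitDegree p a x = 3 := by
  classical
  rw [orbitDegree_eq, ← card_filter_linked hs hc a, filter_filter]
  congr 1
  ext v
  simp [hall v]

theorem sum_orbitDegree_two (hs : Γ.IsSimple) (hc : Γ.IsCubic) (hxy : ¬ SameOrbit p x y)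
    (hall : ∀ v, SameOrbit p x v ∨ SameOrbit p y v)
    (a : Γ.V) : orbitDegree p a x + orbitDegree p a y = 3 := by
  classical
  rw [orbitDegree_eq, orbitDegree_eq, ← card_filter_linked hs hc a, filter_filter, filter_filter,
    ← card_union_of_disjoint]
  · congr 1
    ext v
    have := hall v
    simp only [mem_union, mem_filter, mem_univ, true_and]
    tauto
  · rw [disjoint_filter]
    exact fun v _ h h' => hxy (h.1.trans h'.1.symm)

theorem sum_orbitDegree_three (hs : Γ.IsSimple) (hc : Γ.IsCubic) (hxy : ¬ SameOrbit p x y)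
    (hxz : ¬ SameOrbit p x z) (hyz : ¬ SameOrbit p y z)
    (hall : ∀ v, SameOrbit p x v ∨ SameOrbit p y v ∨ SameOrbit p z v)
    (a : Γ.V) : orbitDegree p a x + orbitDegree p a y + orbitDegree p a z = 3 := by
  classical
  rw [orbitDegree_eq, orbitDegree_eq, orbitDegree_eq, ← card_filter_linked hs hc a, filter_filter,
    filter_filter, filter_filter, ← card_union_of_disjoint, ← card_union_of_disjoint]
  · congr 1
    ext v
    have := hall v
    simp only [mem_union, mem_filter, mem_univ, true_and]
    tauto
  · rw [disjoint_union_left, disjoint_filter, disjoint_filter]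
    exact ⟨fun v _ h h' => hxz (h.1.trans h'.1.symm), fun v _ h h' => hyz (h.1.trans h'.1.symm)⟩
  · rw [disjoint_filter]
    exact fun v _ h h' => hxy (h.1.trans h'.1.symm)

end Fintype

theorem zero_mem_residues [Finite Γ.V] (h : Γ.Linked a b) : 0 ∈ residues p a b :=
  mem_residues.2 ⟨period_pos p b, by simpa using h⟩

theorem exists_linked_of_orbitDegree_pos (h : 0 < orbitDegree p a b) :
    ∃ c, SameOrbit p b c ∧ Γ.Linked a c := by
  obtain ⟨n, hn⟩ := card_pos.1 h
  exact ⟨_, ⟨n, by rw [zpow_natCast]⟩, (mem_residues.1 hn).2⟩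

theorem exists_residue (h : 0 < orbitDegree p a b) :
    ∃ r < MulAction.period p b, Γ.Linked a (p ^ r • b) := by
  obtain ⟨n, hn⟩ := card_pos.1 h
  exact ⟨n, mem_residues.1 hn⟩

theorem exists_two_residues (h : 1 < orbitDegree p a b) :
    ∃ r s, r ≠ s ∧ (r < MulAction.period p b ∧ Γ.Linked a (p ^ r • b)) ∧
      (s < MulAction.period p b ∧ Γ.Linked a (p ^ s • b)) := by
  obtain ⟨r, hr, s, hs, hrs⟩ := one_lt_card.1 h
  exact ⟨r, s, hrs, mem_residues.1 hr, mem_residues.1 hs⟩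

/-- Gives the voltage of a second link parallel to one of voltage zero. -/
theorem exists_pos_residue (h : 1 < orbitDegree p a b) :
    ∃ r, r ≠ 0 ∧ r < MulAction.period p b ∧ Γ.Linked a (p ^ r • b) := by
  obtain ⟨r, s, hrs, hr, hs⟩ := exists_two_residues h
  by_cases h0 : r = 0
  · exact ⟨s, by omega, hs⟩
  · exact ⟨r, h0, hr⟩

theorem exists_two_pos_residues (h : 2 < orbitDegree p a b) :
    ∃ r s, 0 < r ∧ r < s ∧ (r < MulAction.period p b ∧ Γ.Linked a (p ^ r • b)) ∧
      (s < MulAction.period p b ∧ Γ.Linked a (p ^ s • b)) := by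
  have : 1 < #((residues p a b).erase 0) := by
    have := pred_card_le_card_erase (s := residues p a b) (a := 0)
    unfold orbitDegree at h
    omega
  obtain ⟨r, hr, s, hs, hrs⟩ := one_lt_card.1 this
  rw [mem_erase] at hr hs
  rcases lt_or_gt_of_ne hrs with h' | h'
  · exact ⟨r, s, by omega, h', mem_residues.1 hr.2, mem_residues.1 hs.2⟩
  · exact ⟨s, r, by omega, h', mem_residues.1 hs.2, mem_residues.1 hr.2⟩

theorem pos_of_mem_residues_self (hs : Γ.IsSimple) {n : ℕ} (h : n ∈ residues p a a) : 0 < n := by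
  rw [Nat.pos_iff_ne_zero]
  rintro rfl
  have := (mem_residues.1 h).2
  rw [pow_zero, one_smul] at this
  exact hs.linked_irrefl a this

/-- Reverse the edge from `a` to `p ^ n • a` and apply `p ^ (m - n)`, where `m` is the period. -/
theorem sub_mem_residues_self (hs : Γ.IsSimple) {n : ℕ} (h : n ∈ residues p a a) :
    MulAction.period p a - n ∈ residues p a a := by
  have hpos := pos_of_mem_residues_self hs h
  rw [mem_residues] at h ⊢
  refine ⟨by omega, ?_⟩
  have := (linked_zpow_smul (p := p) (MulAction.period p a - n)).2 h.2.symm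
  rw [← zpow_natCast, smul_smul, ← zpow_add, sub_add_cancel, zpow_natCast,
    MulAction.pow_period_smul, ← Nat.cast_sub h.1.le, zpow_natCast] at this
  exact this

/-- A vertex with an odd number of neighbours in its own orbit. -/
theorem even_period_of_odd (hs : Γ.IsSimple) (h : Odd (orbitDegree p a a)) :
    Even (MulAction.period p a) ∧ Γ.Linked a (p ^ (MulAction.period p a / 2) • a) := by
  set m := MulAction.period p a with hm
  have hlt : ∀ n ∈ residues p a a, 0 < n ∧ n < m := fun n hn =>
    ⟨pos_of_mem_residues_self hs hn, (mem_residues.1 hn).1⟩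
  -- A fixed point of `n ↦ m - n` is `m / 2`. Without one the involution pairs off the exponents,
  -- and their number, computed in `ZMod 2`, vanishes.
  by_cases hfix : ∃ n ∈ residues p a a, m - n = n
  · obtain ⟨n, hn, hmn⟩ := hfix
    have := hlt n hn
    obtain rfl : m / 2 = n := by omega
    exact ⟨⟨m / 2, by omega⟩, (mem_residues.1 hn).2⟩
  · push Not at hfix
    have hev : Even #(residues p a a) := by
      rw [← ZMod.natCast_eq_zero_iff_even, ← nsmul_one, ← sum_const]
      refine sum_involution (fun n _ => m - n) (fun _ _ => by decide) (fun n hn _ => hfix n hn)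
        (fun n hn => sub_mem_residues_self hs hn) fun n hn => ?_
      have := hlt n hn
      omega
    exact absurd hev (Nat.not_even_iff_odd.2 h)

/-- Of two distinct exponents at most one is half the period. -/
theorem exists_loop_residue (hs : Γ.IsSimple) (h : 1 < orbitDegree p a a) :
    ∃ r, (0 < r ∧ r < MulAction.period p a ∧ 2 * r ≠ MulAction.period p a) ∧
      Γ.Linked a (p ^ r • a) := by
  obtain ⟨r, hr, s, hs', hrs⟩ := one_lt_card.1 h
  have hr0 := pos_of_mem_residues_self hs hr
  have hs0 := pos_of_mem_residues_self hs hs'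
  rw [mem_residues] at hr hs'
  by_cases h2 : 2 * r = MulAction.period p a
  · exact ⟨s, ⟨hs0, hs'.1, by omega⟩, hs'.2⟩
  · exact ⟨r, ⟨hr0, hr.1, h2⟩, hr.2⟩

end DartGraph

/-! ### Three orbits: degree patterns and the matching diagrams. -/

namespace DartGraph

open Finset

variable {Γ : DartGraph.{u, v}} {p : Γ.Aut}

/-- Finite, connected, cubic and simple graphs. -/
structure IsCubicNetwork (Γ : DartGraph.{u, v}) : Prop where
  finite : Finite Γ.V
  connected : Γ.Connected
  cubic : Γ.IsCubic
  simple : Γ.IsSimple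

theorem linked_pow_zero {a b : Γ.V} (h : Γ.Linked a b) : Γ.Linked a (p ^ 0 • b) := by
  rwa [pow_zero, one_smul]

/-- The equation `hd`, proved by `rfl` in each application, lets the diagram appear with explicit
indices and edges. -/
theorem isListed_of_eq (hΓ : IsCubicNetwork Γ) {i m r s : ℕ} {d : Diagram}
    (hd : diagram i m r s = d) (hm : 0 < m) (hcond : LocalConditions i m r s) (hred : d.Reduced)
    (w : Fin d.n → Γ.V) (hper : ∀ a, MulAction.period p (w a) = d.iota a)
    (horb : ∀ a b, SameOrbit p (w a) (w b) → a = b) (hall : ∀ v, ∃ a, SameOrbit p (w a) v)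
    (hedge : ∀ e ∈ d.edges, Realises p w d.iota e) : Γ.IsListed := by
  subst hd
  exact isListed_of_realises hΓ.simple hΓ.cubic hΓ.connected ⟨hm, hcond, hred⟩ w hper
    (fun a b k h => horb a b ⟨k, h⟩) hall hedge

theorem isListed_one (hΓ : IsCubicNetwork Γ) {i m r s A : ℕ} {es : List (DEdge 1)}
    (hd : diagram i m r s = ⟨1, ![A], es⟩) (hm : 0 < m) (hcond : LocalConditions i m r s)
    (hred : es.Forall (DEdge.Reduced ![A])) {x : Γ.V} (hx : MulAction.period p x = A)
    (hall : ∀ v, SameOrbit p x v) (hedge : es.Forall (Realises p ![x] ![A])) : Γ.IsListed := by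
  refine isListed_of_eq hΓ hd hm hcond (Diagram.reduced_iff_forall.2 hred) ![x] ?_ ?_ ?_
    (List.forall_iff_forall_mem.1 hedge)
  · simpa using hx
  · exact fun a b _ => Subsingleton.elim (α := Fin 1) a b
  · exact fun v => ⟨(0 : Fin 1), hall v⟩

theorem isListed_two (hΓ : IsCubicNetwork Γ) {i m r s A B : ℕ} {es : List (DEdge 2)}
    (hd : diagram i m r s = ⟨2, ![A, B], es⟩) (hm : 0 < m) (hcond : LocalConditions i m r s)
    (hred : es.Forall (DEdge.Reduced ![A, B])) {x y : Γ.V} (hx : MulAction.period p x = A)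
    (hy : MulAction.period p y = B) (hxy : ¬ SameOrbit p x y)
    (hall : ∀ v, SameOrbit p x v ∨ SameOrbit p y v)
    (hedge : es.Forall (Realises p ![x, y] ![A, B])) : Γ.IsListed := by
  refine isListed_of_eq hΓ hd hm hcond (Diagram.reduced_iff_forall.2 hred) ![x, y] ?_ ?_ ?_
    (List.forall_iff_forall_mem.1 hedge)
  · simp [Fin.forall_fin_succ, hx, hy]
  · have hyx : ¬ SameOrbit p y x := fun h => hxy h.symm
    simp [Fin.forall_fin_succ, hxy, hyx]
  · intro v
    simpa [Fin.exists_fin_succ] using hall v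

theorem isListed_three (hΓ : IsCubicNetwork Γ) {i m r s A B C : ℕ} {es : List (DEdge 3)}
    (hd : diagram i m r s = ⟨3, ![A, B, C], es⟩) (hm : 0 < m) (hcond : LocalConditions i m r s)
    (hred : es.Forall (DEdge.Reduced ![A, B, C])) {x y z : Γ.V} (hx : MulAction.period p x = A)
    (hy : MulAction.period p y = B) (hz : MulAction.period p z = C) (hxy : ¬ SameOrbit p x y)
    (hxz : ¬ SameOrbit p x z) (hyz : ¬ SameOrbit p y z)
    (hall : ∀ v, SameOrbit p x v ∨ SameOrbit p y v ∨ SameOrbit p z v)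
    (hedge : es.Forall (Realises p ![x, y, z] ![A, B, C])) : Γ.IsListed := by
  refine isListed_of_eq hΓ hd hm hcond (Diagram.reduced_iff_forall.2 hred) ![x, y, z] ?_ ?_ ?_
    (List.forall_iff_forall_mem.1 hedge)
  · simp [Fin.forall_fin_succ, hx, hy, hz]
  · have hyx : ¬ SameOrbit p y x := fun h => hxy h.symm
    have hzx : ¬ SameOrbit p z x := fun h => hxz h.symm
    have hzy : ¬ SameOrbit p z y := fun h => hyz h.symm
    simp [Fin.forall_fin_succ, hxy, hyx, hxz, hzx, hyz, hzy]
  · intro v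
    simpa [Fin.exists_fin_succ] using hall v

theorem exists_semi (hΓ : IsCubicNetwork Γ) {a : Γ.V} {A d : ℕ} (hA : MulAction.period p a = A)
    (hd : orbitDegree p a a = d) (h : Odd d) : Even A ∧ Γ.Linked a (p ^ (A / 2) • a) := by
  subst hA hd
  exact even_period_of_odd hΓ.simple h

theorem exists_loop (hΓ : IsCubicNetwork Γ) {a : Γ.V} {A d : ℕ} (hA : MulAction.period p a = A)
    (hd : orbitDegree p a a = d) (h : 1 < d) :
    ∃ r, (0 < r ∧ r < A ∧ 2 * r ≠ A) ∧ Γ.Linked a (p ^ r • a) := by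
  subst hA hd
  exact exists_loop_residue hΓ.simple h

theorem pos_of_mul_eq_mul {a b X Y : ℕ} (h : a * X = b * Y) (hb : 0 < b) (hY : 0 < Y) : 0 < a := by
  rw [Nat.pos_iff_ne_zero]
  rintro rfl
  have := Nat.mul_pos hb hY
  omega

/-- Three representatives of the orbits, with the lengths of the orbits and the numbers of
neighbours in the orbits. -/
structure Profile (p : Γ.Aut) (x y c : Γ.V) (X Y C xx xy xc yx yy yc cx cy cc : ℕ) : Prop where
  hX : MulAction.period p x = X
  hY : MulAction.period p y = Y
  hC : MulAction.period p c = C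
  posX : 0 < X
  posY : 0 < Y
  posC : 0 < C
  hxx : orbitDegree p x x = xx
  hxy : orbitDegree p x y = xy
  hxc : orbitDegree p x c = xc
  hyx : orbitDegree p y x = yx
  hyy : orbitDegree p y y = yy
  hyc : orbitDegree p y c = yc
  hcx : orbitDegree p c x = cx
  hcy : orbitDegree p c y = cy
  hcc : orbitDegree p c c = cc
  sum_x : xx + xy + xc = 3
  sum_y : yx + yy + yc = 3
  sum_c : cx + cy + cc = 3
  bal_xy : xy * X = yx * Y
  bal_xc : xc * X = cx * C
  bal_yc : yc * Y = cy * C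
  not_xy : ¬ SameOrbit p x y
  not_xc : ¬ SameOrbit p x c
  not_yc : ¬ SameOrbit p y c
  all : ∀ v, SameOrbit p x v ∨ SameOrbit p y v ∨ SameOrbit p c v

/-- The lengths and degrees enter `Profile` as free numbers, so that later case splits can
substitute values for them. -/
theorem profile_of_orbits (hΓ : IsCubicNetwork Γ) {x y c : Γ.V} (hxy : ¬ SameOrbit p x y)
    (hxc : ¬ SameOrbit p x c) (hyc : ¬ SameOrbit p y c)
    (hall : ∀ v, SameOrbit p x v ∨ SameOrbit p y v ∨ SameOrbit p c v) :
    Profile p x y c (MulAction.period p x) (MulAction.period p y) (MulAction.period p c)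
      (orbitDegree p x x) (orbitDegree p x y) (orbitDegree p x c)
      (orbitDegree p y x) (orbitDegree p y y) (orbitDegree p y c)
      (orbitDegree p c x) (orbitDegree p c y) (orbitDegree p c c) := by
  have := hΓ.finite
  have := Fintype.ofFinite Γ.V
  have hsum := sum_orbitDegree_three hΓ.simple hΓ.cubic hxy hxc hyc hall
  exact ⟨rfl, rfl, rfl, period_pos p x, period_pos p y, period_pos p c, rfl, rfl, rfl, rfl, rfl,
    rfl, rfl, rfl, rfl, hsum x, hsum y, hsum c, orbitDegree_mul_period p x y,
    orbitDegree_mul_period p x c, orbitDegree_mul_period p y c, hxy, hxc, hyc, hall⟩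

namespace Profile

variable {x y c : Γ.V} {X Y C xx xy xc yx yy yc cx cy cc : ℕ}

theorem swap (P : Profile p x y c X Y C xx xy xc yx yy yc cx cy cc) :
    Profile p y x c Y X C yy yx yc xy xx xc cy cx cc :=
  ⟨P.hY, P.hX, P.hC, P.posY, P.posX, P.posC, P.hyy, P.hyx, P.hyc, P.hxy, P.hxx, P.hxc, P.hcy,
    P.hcx, P.hcc, by linarith [P.sum_y], by linarith [P.sum_x], by linarith [P.sum_c],
    P.bal_xy.symm, P.bal_yc, P.bal_xc, fun h => P.not_xy h.symm, P.not_yc, P.not_xc,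
    fun v => by have := P.all v; tauto⟩

theorem rotate (P : Profile p x y c X Y C xx xy xc yx yy yc cx cy cc) :
    Profile p y c x Y C X yy yc yx cy cc cx xy xc xx :=
  ⟨P.hY, P.hC, P.hX, P.posY, P.posC, P.posX, P.hyy, P.hyc, P.hyx, P.hcy, P.hcc, P.hcx, P.hxy,
    P.hxc, P.hxx, by linarith [P.sum_y], by linarith [P.sum_c], by linarith [P.sum_x],
    P.bal_yc, P.bal_xy.symm, P.bal_xc.symm, P.not_yc, fun h => P.not_xy h.symm,
    fun h => P.not_xc h.symm, fun v => by have := P.all v; tauto⟩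

/-- The representatives of two orbits can be chosen among the neighbours of the third one. -/
theorem exists_linked (hΓ : IsCubicNetwork Γ)
    (P : Profile p x y c X Y C xx xy xc yx yy yc cx cy cc) (hx : 0 < cx) (hy : 0 < cy) :
    ∃ x' y', Profile p x' y' c X Y C xx xy xc yx yy yc cx cy cc ∧
      Γ.Linked c x' ∧ Γ.Linked c y' := by
  have := hΓ.finite
  have := Fintype.ofFinite Γ.V
  obtain ⟨x', sx, lx⟩ := exists_linked_of_orbitDegree_pos (P.hcx ▸ hx)
  obtain ⟨y', sy, ly⟩ := exists_linked_of_orbitDegree_pos (P.hcy ▸ hy)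
  have h1 := fun a => orbitDegree_congr_right (a := a) sx
  have h2 := fun a => orbitDegree_congr_right (a := a) sy
  have h3 := fun a => orbitDegree_congr_left (c := a) sx
  have h4 := fun a => orbitDegree_congr_left (c := a) sy
  refine ⟨x', y', ⟨sx.period_eq ▸ P.hX, sy.period_eq ▸ P.hY, P.hC, P.posX, P.posY, P.posC,
    ?_, ?_, ?_, ?_, ?_, ?_, ?_, ?_, P.hcc, P.sum_x, P.sum_y, P.sum_c, P.bal_xy, P.bal_xc,
    P.bal_yc, fun h => P.not_xy (sx.trans (h.trans sy.symm)), fun h => P.not_xc (sx.trans h),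
    fun h => P.not_yc (sy.trans h), fun v => ?_⟩, lx, ly⟩
  · rw [← h1, ← h3, P.hxx]
  · rw [← h2, ← h3, P.hxy]
  · rw [← h3, P.hxc]
  · rw [← h1, ← h4, P.hyx]
  · rw [← h2, ← h4, P.hyy]
  · rw [← h4, P.hyc]
  · rw [← h1, P.hcx]
  · rw [← h2, P.hcy]
  · rcases P.all v with h | h | h
    · exact Or.inl (sx.symm.trans h)
    · exact Or.inr (Or.inl (sy.symm.trans h))
    · exact Or.inr (Or.inr h)

/-- The quotient is a path with middle `c`. Balance gives `xc * X = C = yc * Y`, so the degrees `xc`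
and `yc` fix all lengths up to scale; six of the nine patterns satisfy `xc ≤ yc`. The links at `c`
get voltage zero from `lx` and `ly`. -/
theorem isListed_of_path_one_one (hΓ : IsCubicNetwork Γ)
    (P : Profile p x y c X Y C xx 0 xc 0 yy yc 1 1 1) (lx : Γ.Linked c x) (ly : Γ.Linked c y)
    (hle : xc ≤ yc) : Γ.IsListed := by
  have hx := P.sum_x
  have hy := P.sum_y
  have hb := P.bal_xy
  have hbx := P.bal_xc
  have hby := P.bal_yc
  have pX := P.posX
  have pY := P.posY
  have pC := P.posC
  have hxc := pos_of_mul_eq_mul hbx (by omega) pC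
  have hyc := pos_of_mul_eq_mul hby (by omega) pC
  have ncx : ¬ SameOrbit p c x := fun h => P.not_xc h.symm
  have ncy : ¬ SameOrbit p c y := fun h => P.not_yc h.symm
  have nyx : ¬ SameOrbit p y x := fun h => P.not_xy h.symm
  have hxcy : ∀ v, SameOrbit p x v ∨ SameOrbit p c v ∨ SameOrbit p y v :=
    fun v => by have := P.all v; tauto
  have hycx : ∀ v, SameOrbit p y v ∨ SameOrbit p c v ∨ SameOrbit p x v :=
    fun v => by have := P.all v; tauto
  obtain ⟨eC, lC⟩ := exists_semi hΓ P.hC P.hcc odd_one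
  have cases : (xc = 1 ∧ xx = 2) ∨ (xc = 2 ∧ xx = 1) ∨ (xc = 3 ∧ xx = 0) := by omega
  have cases' : (yc = 1 ∧ yy = 2) ∨ (yc = 2 ∧ yy = 1) ∨ (yc = 3 ∧ yy = 0) := by omega
  rcases cases with ⟨rfl, rfl⟩ | ⟨rfl, rfl⟩ | ⟨rfl, rfl⟩ <;>
    rcases cases' with ⟨rfl, rfl⟩ | ⟨rfl, rfl⟩ | ⟨rfl, rfl⟩ <;> first | omega | skip
  · obtain ⟨r, hr, lr⟩ := exists_loop hΓ P.hX P.hxx one_lt_two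
    obtain ⟨s, hs, ls⟩ := exists_loop hΓ P.hY P.hyy one_lt_two
    obtain rfl : X = C := by omega
    obtain rfl : X = Y := by omega
    exact isListed_three hΓ (i := 25) (m := X) (r := r) (s := s) rfl pX eC
      (by simp; omega) P.hX P.hC P.hY P.not_xc P.not_xy ncy hxcy
      ⟨linked_pow_zero lx.symm, linked_pow_zero ly, lr, lC, ls⟩
  · obtain ⟨r, hr, lr⟩ := exists_loop hΓ P.hX P.hxx one_lt_two
    obtain ⟨eY, lY⟩ := exists_semi hΓ P.hY P.hyy odd_one
    obtain rfl : X = 2 * Y := by omega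
    obtain rfl : C = 2 * Y := by omega
    exact isListed_three hΓ (i := 12) (m := Y) (r := r) (s := 0) rfl pY eY
      (by simp; omega) P.hY P.hC P.hX P.not_yc nyx ncx hycx
      ⟨linked_pow_zero ly.symm, linked_pow_zero lx, lY, lC, lr⟩
  · obtain ⟨r, hr, lr⟩ := exists_loop hΓ P.hX P.hxx one_lt_two
    obtain rfl : X = 3 * Y := by omega
    obtain rfl : C = 3 * Y := by omega
    exact isListed_three hΓ (i := 13) (m := Y) (r := r) (s := 0) rfl pY (by simp only [Nat.even_iff] at *; simp only [LocalConditions, Nat.even_iff]; omega)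
      (by simp; omega) P.hY P.hC P.hX P.not_yc nyx ncx hycx
      ⟨linked_pow_zero ly.symm, linked_pow_zero lx, lC, lr⟩
  · obtain ⟨eX, lX⟩ := exists_semi hΓ P.hX P.hxx odd_one
    obtain ⟨eY, lY⟩ := exists_semi hΓ P.hY P.hyy odd_one
    obtain rfl : X = C / 2 := by omega
    obtain rfl : Y = C / 2 := by omega
    -- The semi-edges at the ends make `C / 2` even, whence `4 ∣ C`.
    exact isListed_three hΓ (i := 9) (m := C) (r := 0) (s := 0) rfl pC (by simp only [Nat.even_iff] at *; simp only [LocalConditions]; omega)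
      (by simp; omega) P.hX P.hY P.hC P.not_xy P.not_xc P.not_yc P.all
      ⟨linked_pow_zero lx.symm, linked_pow_zero ly.symm, lX, lY, lC⟩
  · obtain ⟨eX, lX⟩ := exists_semi hΓ P.hX P.hxx odd_one
    obtain rfl : X = 3 * Y / 2 := by omega
    obtain rfl : C = 3 * Y := by omega
    exact isListed_three hΓ (i := 10) (m := Y) (r := 0) (s := 0) rfl pY (by simp only [Nat.even_iff] at *; simp only [LocalConditions]; omega)
      (by simp; omega) P.hY P.hC P.hX P.not_yc nyx ncx hycx
      ⟨linked_pow_zero ly.symm, linked_pow_zero lx, lC, lX⟩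
  · obtain rfl : X = C / 3 := by omega
    obtain rfl : Y = C / 3 := by omega
    exact isListed_three hΓ (i := 15) (m := C) (r := 0) (s := 0) rfl pC (by simp only [Nat.even_iff] at *; simp only [LocalConditions]; omega)
      (by simp; omega) P.hX P.hY P.hC P.not_xy P.not_xc P.not_yc P.all
      ⟨linked_pow_zero lx.symm, linked_pow_zero ly.symm, lC⟩

/-- Here `xc * X = C` and `yc * Y = 2 * C`. All nine patterns occur. For `yc = 2` the orbits of `c`
and `y` have equal length and are joined by two links, the second with a nonzero voltage; for `yc =
1` or `3` one link with coprime labels suffices. -/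
theorem isListed_of_path_one_two (hΓ : IsCubicNetwork Γ)
    (P : Profile p x y c X Y C xx 0 xc 0 yy yc 1 2 cc) (lx : Γ.Linked c x) (ly : Γ.Linked c y) :
    Γ.IsListed := by
  have hx := P.sum_x
  have hy := P.sum_y
  have hb := P.bal_xy
  have hbx := P.bal_xc
  have hby := P.bal_yc
  have pX := P.posX
  have pY := P.posY
  have pC := P.posC
  have hxc := pos_of_mul_eq_mul hbx (by omega) pC
  have hyc := pos_of_mul_eq_mul hby (by omega) pC
  have ncx : ¬ SameOrbit p c x := fun h => P.not_xc h.symm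
  have ncy : ¬ SameOrbit p c y := fun h => P.not_yc h.symm
  have nyx : ¬ SameOrbit p y x := fun h => P.not_xy h.symm
  have hxcy : ∀ v, SameOrbit p x v ∨ SameOrbit p c v ∨ SameOrbit p y v :=
    fun v => by have := P.all v; tauto
  have hycx : ∀ v, SameOrbit p y v ∨ SameOrbit p c v ∨ SameOrbit p x v :=
    fun v => by have := P.all v; tauto
  have cases : (xc = 1 ∧ xx = 2) ∨ (xc = 2 ∧ xx = 1) ∨ (xc = 3 ∧ xx = 0) := by omega
  have cases' : (yc = 1 ∧ yy = 2) ∨ (yc = 2 ∧ yy = 1) ∨ (yc = 3 ∧ yy = 0) := by omega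
  rcases cases' with ⟨rfl, rfl⟩ | ⟨rfl, rfl⟩ | ⟨rfl, rfl⟩ <;>
    rcases cases with ⟨rfl, rfl⟩ | ⟨rfl, rfl⟩ | ⟨rfl, rfl⟩
  · obtain ⟨r, hr, lr⟩ := exists_loop hΓ P.hX P.hxx one_lt_two
    obtain ⟨s, hs, ls⟩ := exists_loop hΓ P.hY P.hyy one_lt_two
    obtain rfl : X = C := by omega
    obtain rfl : Y = 2 * X := by omega
    exact isListed_three hΓ (i := 17) (m := X) (r := r) (s := s) rfl pX trivial
      (by simp; omega) P.hX P.hC P.hY P.not_xc P.not_xy ncy hxcy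
      ⟨linked_pow_zero lx.symm, linked_pow_zero ly, lr, ls⟩
  · obtain ⟨r, hr, lr⟩ := exists_loop hΓ P.hY P.hyy one_lt_two
    obtain ⟨eX, lX⟩ := exists_semi hΓ P.hX P.hxx odd_one
    obtain rfl : C = 2 * X := by omega
    obtain rfl : Y = 4 * X := by omega
    exact isListed_three hΓ (i := 18) (m := X) (r := r) (s := 0) rfl pX eX
      (by simp; omega) P.hX P.hC P.hY P.not_xc P.not_xy ncy hxcy
      ⟨linked_pow_zero lx.symm, linked_pow_zero ly, lX, lr⟩
  · obtain ⟨r, hr, lr⟩ := exists_loop hΓ P.hY P.hyy one_lt_two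
    obtain rfl : C = 3 * X := by omega
    obtain rfl : Y = 6 * X := by omega
    exact isListed_three hΓ (i := 19) (m := X) (r := r) (s := 0) rfl pX trivial
      (by simp; omega) P.hX P.hC P.hY P.not_xc P.not_xy ncy hxcy
      ⟨linked_pow_zero lx.symm, linked_pow_zero ly, lr⟩
  · obtain ⟨r, h0, hr, lr⟩ := exists_pos_residue (p := p) (a := y) (b := c) (by rw [P.hyc]; norm_num)
    rw [P.hC] at hr
    obtain ⟨s, hs, ls⟩ := exists_loop hΓ P.hX P.hxx one_lt_two
    obtain ⟨eY, lY⟩ := exists_semi hΓ P.hY P.hyy odd_one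
    obtain rfl : X = C := by omega
    obtain rfl : X = Y := by omega
    exact isListed_three hΓ (i := 22) (m := X) (r := r) (s := s) rfl pX ⟨eY, h0⟩
      (by simp; omega) P.hY P.hC P.hX P.not_yc nyx ncx hycx
      ⟨linked_pow_zero ly.symm, linked_pow_zero lx, lr, lY, ls⟩
  · obtain ⟨r, h0, hr, lr⟩ := exists_pos_residue (p := p) (a := c) (b := y) (by rw [P.hcy]; norm_num)
    rw [P.hY] at hr
    obtain ⟨eX, lX⟩ := exists_semi hΓ P.hX P.hxx odd_one
    obtain ⟨eY, lY⟩ := exists_semi hΓ P.hY P.hyy odd_one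
    obtain rfl : C = 2 * X := by omega
    obtain rfl : Y = 2 * X := by omega
    exact isListed_three hΓ (i := 21) (m := X) (r := r) (s := 0) rfl pX ⟨eX, h0⟩
      (by simp; omega) P.hX P.hC P.hY P.not_xc P.not_xy ncy hxcy
      ⟨linked_pow_zero lx.symm, linked_pow_zero ly, lr, lX, lY⟩
  · obtain ⟨r, h0, hr, lr⟩ := exists_pos_residue (p := p) (a := c) (b := y) (by rw [P.hcy]; norm_num)
    rw [P.hY] at hr
    obtain ⟨eY, lY⟩ := exists_semi hΓ P.hY P.hyy odd_one
    obtain rfl : C = 3 * X := by omega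
    obtain rfl : Y = 3 * X := by omega
    exact isListed_three hΓ (i := 20) (m := X) (r := r) (s := 0) rfl pX (by simp only [Nat.even_iff] at *; simp only [LocalConditions, Nat.even_iff]; omega)
      (by simp; omega) P.hX P.hC P.hY P.not_xc P.not_xy ncy hxcy
      ⟨linked_pow_zero lx.symm, linked_pow_zero ly, lr, lY⟩
  · obtain ⟨r, hr, lr⟩ := exists_loop hΓ P.hX P.hxx one_lt_two
    obtain rfl : C = 3 * Y / 2 := by omega
    obtain rfl : X = 3 * Y / 2 := by omega
    -- Evenness of `Y` comes from `3 * Y = 2 * C`; there is no semi-edge.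
    exact isListed_three hΓ (i := 14) (m := Y) (r := r) (s := 0) rfl pY (by simp only [LocalConditions, Nat.even_iff]; omega)
      (by simp; omega) P.hY P.hC P.hX P.not_yc nyx ncx hycx
      ⟨linked_pow_zero ly.symm, linked_pow_zero lx, lr⟩
  · obtain ⟨eX, lX⟩ := exists_semi hΓ P.hX P.hxx odd_one
    obtain rfl : C = 3 * Y / 2 := by omega
    obtain rfl : X = 3 * Y / 4 := by omega
    exact isListed_three hΓ (i := 11) (m := Y) (r := 0) (s := 0) rfl pY (by simp only [Nat.even_iff] at *; simp only [LocalConditions]; omega)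
      (by simp; omega) P.hY P.hC P.hX P.not_yc nyx ncx hycx
      ⟨linked_pow_zero ly.symm, linked_pow_zero lx, lX⟩
  · obtain rfl : C = 3 * X := by omega
    obtain rfl : Y = 2 * X := by omega
    exact isListed_three hΓ (i := 16) (m := X) (r := 0) (s := 0) rfl pX trivial
      (by simp; omega) P.hX P.hY P.hC P.not_xy P.not_xc P.not_yc P.all
      ⟨linked_pow_zero lx.symm, linked_pow_zero ly.symm⟩

/-- The equations `xc * X = C = yc * Y` and `xy * X = yx * Y` leave only the patterns in which `x`
and `y` have the same degrees. The links at `c` have voltage zero; those from `x` to `y` carry the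
free voltages. -/
theorem isListed_of_triangle_one_one (hΓ : IsCubicNetwork Γ)
    (P : Profile p x y c X Y C xx xy xc yx yy yc 1 1 1) (lx : Γ.Linked c x) (ly : Γ.Linked c y)
    (hle : xc ≤ yc) (hxy : 0 < xy) : Γ.IsListed := by
  have hx := P.sum_x
  have hy := P.sum_y
  have hb := P.bal_xy
  have hbx := P.bal_xc
  have hby := P.bal_yc
  have pX := P.posX
  have pY := P.posY
  have pC := P.posC
  have hxc := pos_of_mul_eq_mul hbx (by omega) pC
  have hyc := pos_of_mul_eq_mul hby (by omega) pC
  have ncx : ¬ SameOrbit p c x := fun h => P.not_xc h.symm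
  have ncy : ¬ SameOrbit p c y := fun h => P.not_yc h.symm
  have nyx : ¬ SameOrbit p y x := fun h => P.not_xy h.symm
  have hxcy : ∀ v, SameOrbit p x v ∨ SameOrbit p c v ∨ SameOrbit p y v :=
    fun v => by have := P.all v; tauto
  have hycx : ∀ v, SameOrbit p y v ∨ SameOrbit p c v ∨ SameOrbit p x v :=
    fun v => by have := P.all v; tauto
  have hyx := pos_of_mul_eq_mul hb.symm hxy pX
  obtain ⟨eC, lC⟩ := exists_semi hΓ P.hC P.hcc odd_one
  obtain ⟨r, hr, lr⟩ := exists_residue (P.hxy ▸ hxy)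
  rw [P.hY] at hr
  have cases : (xc = 1 ∧ xy = 1 ∧ xx = 1) ∨ (xc = 1 ∧ xy = 2 ∧ xx = 0) ∨
      (xc = 2 ∧ xy = 1 ∧ xx = 0) := by omega
  have cases' : (yc = 1 ∧ yx = 1 ∧ yy = 1) ∨ (yc = 1 ∧ yx = 2 ∧ yy = 0) ∨
      (yc = 2 ∧ yx = 1 ∧ yy = 0) := by omega
  rcases cases with ⟨rfl, rfl, rfl⟩ | ⟨rfl, rfl, rfl⟩ | ⟨rfl, rfl, rfl⟩ <;>
    rcases cases' with ⟨rfl, rfl, rfl⟩ | ⟨rfl, rfl, rfl⟩ | ⟨rfl, rfl, rfl⟩ <;>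
    first | omega | skip
  · obtain ⟨eX, lX⟩ := exists_semi hΓ P.hX P.hxx odd_one
    obtain ⟨eY, lY⟩ := exists_semi hΓ P.hY P.hyy odd_one
    obtain rfl : X = C := by omega
    obtain rfl : X = Y := by omega
    exact isListed_three hΓ (i := 24) (m := X) (r := r) (s := 0) rfl pX eX
      (by simp; omega) P.hX P.hC P.hY P.not_xc P.not_xy ncy hxcy
      ⟨linked_pow_zero lx.symm, linked_pow_zero ly, lr, lX, lC, lY⟩
  · obtain ⟨r, s, hrs, ⟨hr, lr⟩, hs, ls⟩ :=
      exists_two_residues (p := p) (a := x) (b := y) (by rw [P.hxy]; norm_num)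
    rw [P.hY] at hr hs
    obtain rfl : X = C := by omega
    obtain rfl : X = Y := by omega
    exact isListed_three hΓ (i := 23) (m := X) (r := r) (s := s) rfl pX ⟨eC, hrs⟩
      (by simp; omega) P.hX P.hC P.hY P.not_xc P.not_xy ncy hxcy
      ⟨linked_pow_zero lx.symm, linked_pow_zero ly, lr, ls, lC⟩
  · obtain rfl : C = 2 * X := by omega
    obtain rfl : X = Y := by omega
    exact isListed_three hΓ (i := 8) (m := X) (r := r) (s := 0) rfl pX trivial
      (by simp; omega) P.hX P.hY P.hC P.not_xy P.not_xc P.not_yc P.all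
      ⟨linked_pow_zero lx.symm, linked_pow_zero ly.symm, lr, lC⟩

theorem isListed_of_centre_one_one (hΓ : IsCubicNetwork Γ)
    (P : Profile p x y c X Y C xx xy xc yx yy yc 1 1 1) : Γ.IsListed := by
  wlog hle : xc ≤ yc generalizing x y X Y xx xy xc yx yy yc
  · exact this P.swap (by omega)
  obtain ⟨x', y', P', lx, ly⟩ := P.exists_linked hΓ one_pos one_pos
  by_cases hxy : xy = 0
  · subst hxy
    have hyx : yx = 0 := by
      by_contra h
      exact absurd (pos_of_mul_eq_mul P.bal_xy (by omega) P.posY) (by omega)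
    subst hyx
    exact P'.isListed_of_path_one_one hΓ lx ly hle
  · exact P'.isListed_of_triangle_one_one hΓ lx ly hle (by omega)

/-- Either `c` has one neighbour in every orbit, or the quotient is a path, or it is a triangle in
which `x` or `y` can take over the role of `c`. -/
theorem isListed_of_centre (hΓ : IsCubicNetwork Γ)
    (P : Profile p x y c X Y C xx xy xc yx yy yc cx cy cc) (hcx : 0 < cx) (hcy : 0 < cy) :
    Γ.IsListed := by
  wlog hle : cx ≤ cy generalizing x y X Y xx xy xc yx yy yc cx cy
  · exact this P.swap hcy hcx (by omega)
  have hc := P.sum_c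
  have cases : (cx = 1 ∧ cy = 1 ∧ cc = 1) ∨ (cx = 1 ∧ cy = 2 ∧ cc = 0) := by omega
  rcases cases with ⟨rfl, rfl, rfl⟩ | ⟨rfl, rfl, rfl⟩
  · exact P.isListed_of_centre_one_one hΓ
  by_cases hxy : xy = 0
  · subst hxy
    have hyx : yx = 0 := by
      by_contra h
      exact absurd (pos_of_mul_eq_mul P.bal_xy (by omega) P.posY) (by omega)
    subst hyx
    obtain ⟨x', y', P', lx, ly⟩ := P.exists_linked hΓ hcx hcy
    exact P'.isListed_of_path_one_two hΓ lx ly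
  have hx := P.sum_x
  have hy := P.sum_y
  have hb := P.bal_xy
  have hbx := P.bal_xc
  have hby := P.bal_yc
  have pX := P.posX
  have pY := P.posY
  have pC := P.posC
  have hyx := pos_of_mul_eq_mul hb.symm (Nat.pos_of_ne_zero hxy) pX
  have hxc := pos_of_mul_eq_mul hbx (by omega) pC
  have hyc := pos_of_mul_eq_mul hby (by omega) pC
  have cases : (xc = 1 ∧ xy = 1 ∧ xx = 1) ∨ (xc = 1 ∧ xy = 2 ∧ xx = 0) ∨
      (xc = 2 ∧ xy = 1 ∧ xx = 0) := by omega
  have cases' : (yc = 1 ∧ yx = 1 ∧ yy = 1) ∨ (yc = 1 ∧ yx = 2 ∧ yy = 0) ∨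
      (yc = 2 ∧ yx = 1 ∧ yy = 0) := by omega
  -- The balances multiplied around the triangle give `2 * xc * yx = yc * xy`. The two solutions
  -- have `x`, respectively `y`, with one neighbour in each orbit.
  rcases cases with ⟨rfl, rfl, rfl⟩ | ⟨rfl, rfl, rfl⟩ | ⟨rfl, rfl, rfl⟩ <;>
    rcases cases' with ⟨rfl, rfl, rfl⟩ | ⟨rfl, rfl, rfl⟩ | ⟨rfl, rfl, rfl⟩ <;>
    first
    | omega
    | exact P.rotate.isListed_of_centre_one_one hΓ
    | exact P.rotate.rotate.isListed_of_centre_one_one hΓ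

end Profile

end DartGraph

/-! ### One, two and three orbits, and the conclusion. -/

namespace DartGraph

open Finset

variable {Γ : DartGraph.{u, v}} {p : Γ.Aut}

theorem isListed_of_one_orbit (hΓ : IsCubicNetwork Γ) {x : Γ.V} (hall : ∀ v, SameOrbit p x v) :
    Γ.IsListed := by
  have := hΓ.finite
  have := Fintype.ofFinite Γ.V
  have h3 := sum_orbitDegree_one hΓ.simple hΓ.cubic hall x
  obtain ⟨e, l⟩ := exists_semi hΓ rfl h3 (by decide)
  obtain ⟨r, hr, lr⟩ := exists_loop hΓ rfl h3 (by decide)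
  exact isListed_one hΓ (i := 1) (m := MulAction.period p x) (r := r) (s := 0) rfl
    (period_pos p x) e (by simpa using hr) rfl hall ⟨l, lr⟩

theorem orbitDegree_pos_of_linked [Finite Γ.V] {a b x y : Γ.V} (h : Γ.Linked a b)
    (hx : SameOrbit p x a) (hy : SameOrbit p y b) : 0 < orbitDegree p x y := by
  have := Fintype.ofFinite Γ.V
  rw [orbitDegree_congr_left hx, orbitDegree_congr_right hy]
  exact card_pos.2 ⟨0, zero_mem_residues h⟩

/-- A union of vertices closed under adjacency is everything, by connectedness. -/
theorem sameOrbit_of_closed (hΓ : IsCubicNetwork Γ) {x : Γ.V}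
    (h : ∀ a b, SameOrbit p x a → Γ.Linked a b → SameOrbit p x b) (v : Γ.V) :
    SameOrbit p x v := by
  have key : ∀ w, Relation.ReflTransGen Γ.Linked x w → SameOrbit p x w := by
    intro w hw
    induction hw with
    | refl => exact .refl p x
    | tail _ hl ih => exact h _ _ ih hl
  exact key v (hΓ.connected x v)

theorem isListed_of_two_orbits (hΓ : IsCubicNetwork Γ) {x y : Γ.V} (hxy : ¬ SameOrbit p x y)
    (hall : ∀ v, SameOrbit p x v ∨ SameOrbit p y v) : Γ.IsListed := by
  have hfin := hΓ.finite
  have hft := Fintype.ofFinite Γ.V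
  wlog hle : orbitDegree p y x ≤ orbitDegree p x y generalizing x y
  · exact this (fun h => hxy h.symm) (fun v => (hall v).symm) (by omega)
  have hpos : 0 < orbitDegree p x y := by
    by_contra h0
    refine hxy (sameOrbit_of_closed hΓ (fun a b ha hl => ?_) y)
    rcases hall b with hb | hb
    · exact hb
    · exact absurd (orbitDegree_pos_of_linked hl ha hb) h0
  -- A representative of the second orbit adjacent to `x` gives the first link voltage zero.
  obtain ⟨y', sy, ly⟩ := exists_linked_of_orbitDegree_pos hpos
  rw [orbitDegree_congr_right (p := p) (a := x) sy,
    orbitDegree_congr_left (p := p) (c := x) sy] at hle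
  rw [orbitDegree_congr_right (p := p) (a := x) sy] at hpos
  replace hxy : ¬ SameOrbit p x y' := fun h => hxy (h.trans sy.symm)
  replace hall : ∀ v, SameOrbit p x v ∨ SameOrbit p y' v :=
    fun v => (hall v).imp_right fun h => sy.symm.trans h
  clear sy y
  rename' y' => y
  have hsum := sum_orbitDegree_two hΓ.simple hΓ.cubic hxy hall
  have hx := hsum x
  have hy := hsum y
  have hb := orbitDegree_mul_period p x y
  have pX := period_pos p x
  have pY := period_pos p y
  obtain ⟨X, hX⟩ : ∃ X, MulAction.period p x = X := ⟨_, rfl⟩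
  obtain ⟨Y, hY⟩ : ∃ Y, MulAction.period p y = Y := ⟨_, rfl⟩
  obtain ⟨xx, hxx⟩ : ∃ d, orbitDegree p x x = d := ⟨_, rfl⟩
  obtain ⟨xy, hxy'⟩ : ∃ d, orbitDegree p x y = d := ⟨_, rfl⟩
  obtain ⟨yx, hyx'⟩ : ∃ d, orbitDegree p y x = d := ⟨_, rfl⟩
  obtain ⟨yy, hyy⟩ : ∃ d, orbitDegree p y y = d := ⟨_, rfl⟩
  rw [hX] at pX
  rw [hY] at pY
  rw [hX, hY, hxy', hyx'] at hb
  rw [hxy'] at hpos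
  rw [hxy', hyx'] at hle
  rw [hxx, hxy'] at hx
  rw [hyy, hyx'] at hy
  have hpos' := pos_of_mul_eq_mul hb.symm hpos pX
  have l0 := linked_pow_zero (p := p) ly
  obtain rfl : xx = 3 - xy := by omega
  obtain rfl : yy = 3 - yx := by omega
  have hxy3 : xy = 1 ∨ xy = 2 ∨ xy = 3 := by omega
  have hyx3 : yx = 1 ∨ yx = 2 ∨ yx = 3 := by omega
  -- All six pairs with `yx ≤ xy` occur. Unequal degrees are coprime and give one link; equal
  -- degrees `k` give `k` parallel links with labels 1.
  rcases hxy3 with rfl | rfl | rfl <;> rcases hyx3 with rfl | rfl | rfl <;>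
    first | (exfalso; clear * - hle; omega) | skip
  · obtain ⟨r, hr, lr⟩ := exists_loop hΓ hX hxx one_lt_two
    obtain ⟨s, hs, ls⟩ := exists_loop hΓ hY hyy one_lt_two
    obtain rfl : X = Y := by omega
    exact isListed_two hΓ (i := 2) (m := X) (r := r) (s := s) rfl pX trivial (by simp; omega)
      hX hY hxy hall ⟨l0, lr, ls⟩
  · obtain ⟨e, lX⟩ := exists_semi hΓ hX hxx odd_one
    obtain ⟨r, hr, lr⟩ := exists_loop hΓ hY hyy one_lt_two
    obtain rfl : Y = 2 * X := by omega
    exact isListed_two hΓ (i := 5) (m := X) (r := r) (s := 0) rfl pX e (by simp; omega)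
      hX hY hxy hall ⟨l0, lX, lr⟩
  · obtain ⟨e, lX⟩ := exists_semi hΓ hX hxx odd_one
    obtain ⟨-, lY⟩ := exists_semi hΓ hY hyy odd_one
    obtain ⟨r, h0, hr, lr⟩ := exists_pos_residue (p := p) (a := x) (b := y) (by omega)
    rw [hY] at hr
    obtain rfl : X = Y := by omega
    exact isListed_two hΓ (i := 3) (m := X) (r := r) (s := 0) rfl pX ⟨e, h0⟩ (by simp; omega)
      hX hY hxy hall ⟨l0, lr, lX, lY⟩
  · obtain ⟨r, hr, lr⟩ := exists_loop hΓ hY hyy one_lt_two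
    obtain rfl : Y = 3 * X := by omega
    exact isListed_two hΓ (i := 6) (m := X) (r := r) (s := 0) rfl pX trivial (by simp; omega)
      hX hY hxy hall ⟨l0, lr⟩
  · obtain ⟨e, lY⟩ := exists_semi hΓ hY hyy odd_one
    rw [Nat.even_iff] at e
    obtain rfl : Y = 3 * X / 2 := by omega
    exact isListed_two hΓ (i := 7) (m := X) (r := 0) (s := 0) rfl pX
      (by simp only [LocalConditions]; omega) (by simp; omega) hX hY hxy hall ⟨l0, lY⟩
  · obtain ⟨r, s, h0, hrs, ⟨hr, lr⟩, hs, ls⟩ :=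
      exists_two_pos_residues (p := p) (a := x) (b := y) (by omega)
    rw [hY] at hr hs
    obtain rfl : X = Y := by omega
    exact isListed_two hΓ (i := 4) (m := X) (r := r) (s := s) rfl pX ⟨h0, hrs⟩
      (by simp; omega) hX hY hxy hall ⟨l0, lr, ls⟩

/-- A connected quotient on three vertices has a vertex adjacent to both others; rotation puts it in
the last place. -/
theorem isListed_of_three_orbits (hΓ : IsCubicNetwork Γ) {x y z : Γ.V}
    (hxy : ¬ SameOrbit p x y) (hxz : ¬ SameOrbit p x z) (hyz : ¬ SameOrbit p y z)
    (hall : ∀ v, SameOrbit p x v ∨ SameOrbit p y v ∨ SameOrbit p z v) : Γ.IsListed := by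
  have hfin := hΓ.finite
  have P := profile_of_orbits hΓ hxy hxz hyz hall
  have leave : ∀ {a b c : Γ.V}, ¬ SameOrbit p a b →
      (∀ v, SameOrbit p a v ∨ SameOrbit p b v ∨ SameOrbit p c v) →
      0 < orbitDegree p a b ∨ 0 < orbitDegree p a c := by
    intro a b c hab hall
    by_contra! h0
    refine hab (sameOrbit_of_closed hΓ (fun u w hu hl => ?_) b)
    rcases hall w with hw | hw | hw
    · exact hw
    · exact absurd (orbitDegree_pos_of_linked hl hu hw) (by omega)
    · exact absurd (orbitDegree_pos_of_linked hl hu hw) (by omega)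
  have h1 := leave hxy hall
  have h2 := leave (a := y) (b := x) (c := z) (fun h => hxy h.symm)
    (fun v => or_left_comm.1 (hall v))
  have h3 := leave (a := z) (b := x) (c := y) (fun h => hxz h.symm)
    (fun v => or_rotate.1 (or_rotate.1 (hall v)))
  -- By the balance, adjacency of orbits is symmetric.
  have i1 := fun h => pos_of_mul_eq_mul P.bal_xy h P.posY
  have i2 := fun h => pos_of_mul_eq_mul P.bal_xc h P.posC
  have i3 := fun h => pos_of_mul_eq_mul P.bal_yc h P.posC
  have i4 := fun h => pos_of_mul_eq_mul P.bal_xy.symm h P.posX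
  have i5 := fun h => pos_of_mul_eq_mul P.bal_xc.symm h P.posX
  have i6 := fun h => pos_of_mul_eq_mul P.bal_yc.symm h P.posY
  have cases : (0 < orbitDegree p z x ∧ 0 < orbitDegree p z y) ∨
      (0 < orbitDegree p x y ∧ 0 < orbitDegree p x z) ∨
      (0 < orbitDegree p y z ∧ 0 < orbitDegree p y x) := by omega
  rcases cases with ⟨ha, hb⟩ | ⟨ha, hb⟩ | ⟨ha, hb⟩
  · exact P.isListed_of_centre hΓ ha hb
  · exact P.rotate.isListed_of_centre hΓ ha hb
  · exact P.rotate.rotate.isListed_of_centre hΓ ha hb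

theorem isListed_of_cyclic (hΓ : IsCubicNetwork Γ) (G : Subgroup Γ.Aut) (hG : IsCyclic G)
    (hcard : Nat.card (MulAction.orbitRel.Quotient G Γ.V) ≤ 3) : Γ.IsListed := by
  have hfin := hΓ.finite
  obtain ⟨g, hg⟩ := hG.exists_generator
  have hsame : ∀ a b : Γ.V, (Quotient.mk'' a : MulAction.orbitRel.Quotient G Γ.V) =
      Quotient.mk'' b ↔ SameOrbit g.1 a b := by
    intro a b
    rw [Quotient.eq'', MulAction.orbitRel_apply, MulAction.mem_orbit_iff]
    constructor
    · rintro ⟨q, hq⟩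
      obtain ⟨k, rfl⟩ := Subgroup.mem_zpowers_iff.1 (hg q)
      exact SameOrbit.symm ⟨k, hq⟩
    · intro h
      obtain ⟨k, hk⟩ := h.symm
      exact ⟨g ^ k, hk⟩
  obtain ⟨e⟩ : Nonempty (MulAction.orbitRel.Quotient G Γ.V ≃
    Fin (Nat.card (MulAction.orbitRel.Quotient G Γ.V))) := ⟨Finite.equivFin _⟩
  generalize Nat.card (MulAction.orbitRel.Quotient G Γ.V) = n at hcard e
  let f : Fin n → Γ.V := fun i => (e.symm i).out
  have hmk : ∀ i, (Quotient.mk'' (f i) : MulAction.orbitRel.Quotient G Γ.V) = e.symm i :=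
    fun i => Quotient.out_eq' _
  have hf : ∀ i j, i ≠ j → ¬ SameOrbit g.1 (f i) (f j) := by
    intro i j hij h
    rw [← hsame, hmk, hmk] at h
    exact hij (e.symm.injective h)
  have hall : ∀ v, ∃ i, SameOrbit g.1 (f i) v := by
    intro v
    refine ⟨e (Quotient.mk'' v), ?_⟩
    rw [← hsame, hmk, Equiv.symm_apply_apply]
  clear_value f
  clear hmk e
  interval_cases n
  -- Zero orbits are impossible because a graph has a vertex.
  · obtain ⟨v⟩ := Γ.nonempty
    exact (hall v).elim fun i => i.elim0
  · refine isListed_of_one_orbit hΓ (x := f 0) (p := g.1) fun v => ?_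
    simpa [Fin.exists_fin_succ] using hall v
  · refine isListed_of_two_orbits hΓ (x := f 0) (y := f 1) (p := g.1) (hf _ _ (by decide))
      fun v => ?_
    simpa [Fin.exists_fin_succ] using hall v
  · refine isListed_of_three_orbits hΓ (x := f 0) (y := f 1) (z := f 2) (p := g.1)
      (hf _ _ (by decide)) (hf _ _ (by decide)) (hf _ _ (by decide)) fun v => ?_
    simpa [Fin.exists_fin_succ] using hall v

end DartGraph

theorem theorem4p1 (Γ : DartGraph.{u, v}) :
    (Finite Γ.V ∧ Γ.Connected ∧ Γ.IsCubic ∧ Γ.IsSimple ∧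
      ∃ G : Subgroup Γ.Aut, IsCyclic G ∧ Nat.card (MulAction.orbitRel.Quotient G Γ.V) ≤ 3) ↔
    ∃ i m r s : ℕ, ∃ h : Admissible i m r s, Nonempty (Γ.Iso (gammaGraph i m r s h)) := by
  constructor
  · rintro ⟨hfin, hconn, hcub, hsim, G, hG, hcard⟩
    exact DartGraph.isListed_of_cyclic ⟨hfin, hconn, hcub, hsim⟩ G hG hcard
  · rintro ⟨i, m, r, s, h, ⟨φ⟩⟩
    exact DartGraph.exists_cyclic_of_iso h φ
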